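/- Let $(M,g)$ be a smooth $n$-dimensional Riemannian manifold. It has a Levi-Civita connection $\nabla$ (the torsion-free connection compatible with $g$); put $R(X,Y)Z=\nabla_X\nabla_YZ-\nabla_Y\nabla_XZ-\nabla_{[X,Y]}Z$. Let $e_1,\dots,e_n$ be a smooth orthonormal frame on an open set $U\subseteq M$ with dual coframe $\omega^i$, and put $\omega^i_j(v)=g(\nabla_v e_j,e_i)$ and $R_{ijkl}=g(R(e_k,e_l)e_j,e_i)$. Repeated indices are summed. For a vector field $X=\xi^je_j$ define $\xi^i_k$ by $d\xi^i+\xi^k\omega^i_k=\xi^i_k\,\omega^k$. Then: 1. The smooth forms $\omega^i_j$ and smooth functions $R_{ijkl}$ are on $U$ the unique solution of the structure equations $d\omega^i=\omega^k\wedge\omega^i_k$, $d\omega^i_j=\omega^k_j\wedge\omega^i_k+\tfrac12R_{ijkl}\,\omega^k\wedge\omega^l$ with $\omega^i_j+\omega^j_i=0$, $R_{ijkl}+R_{ijlk}=0$ and $R_{sijk}+R_{sjki}+R_{skij}=0$. 2. At each $x\in U$, sending the 1-jet of $X$ at $x$ to $(\xi^i(x),\xi^i_k(x))$ is a well-defined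 bijection $J^1_x(TM)\to\mathbb R^n\times\mathbb R^{n\times n}$. So $(x,\xi^i,\xi^i_k)$ are coordinates on $J^1(TM)|_U$, and the following are 1-forms on $J^1(TM)|_U$: $$\theta^i=d\xi^i+\xi^k\omega^i_k-\xi^i_k\,\omega^k,\qquad \theta^i_j=d\xi^i_j-\xi^i_k\,\omega^k_j+\xi^k_j\,\omega^i_k+\xi^kR_{ijkl}\,\omega^l .$$ 3. If $X$ is differentiable at $x\in U$, then $\nabla_{e_k}X=\xi^i_k e_i$ at $x$, and $(L_Xg)_x=0$ if and only if $\xi^j_k+\xi^k_j=0$ at $x$ for all $j,k$. Let $\mathcal S\subset J^1(TM)|_U$ be the locus $\xi^j_k+\xi^k_j=0$. 4. At each point of $\mathcal S$ over $x\in U$, every $v\in T_xM$ has exactly one lift to a tangent vector of $J^1(TM)$ annihilated by all $\theta^i,\theta^i_j$, and this lift satisfies $d\xi^j_k+d\xi^k_j=0$. Thus the forms annihilate an $n$-dimensional distribution that is transverse to the fibres and tangent to $\mathcal S$. 5. Let $W\subseteq U$ be open and let $X$ be a $C^2$ vector field on $W$ with $L_Xg=0$. Then the section $(\xi^i,\xi^i_k)$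 of $J^1(TM)$ over $W$ lies in $\mathcal S$, all $\theta^i$ and $\theta^i_j$ pull back to zero under it, and $\nabla_Y(\nabla X)=R(Y,X)$ for all $Y$. 6. Let $W\subseteq U$ be open. For functions $\xi^i,\xi^i_k$ on $W$, the following are equivalent: (a) they are smooth, the section $(\xi^i,\xi^i_k)$ lies in $\mathcal S$, and all $\theta^i,\theta^i_j$ pull back to zero under it; (b) $X=\xi^je_j$ is a smooth vector field on $W$ with $L_Xg=0$, and $(\xi^i,\xi^i_k)$ are the coordinates of its 1-jet. So smooth integral sections in $\mathcal S$ correspond one-to-one to smooth solutions of the Killing equation. 7. For every open $W\subseteq U$ and every $C^2$ vector field $X$ on $W$, all $\theta^i,\theta^i_j$ pull back to zero under the section $(\xi^i,\xi^i_k)$ given by the 1-jet of $X$ if and only if $\nabla_Y(\nabla X)=R(Y,X)$ on $W$ for all $Y$. 8. There are smooth functions $B^{ij}_{lk}$ and $C^{ijm}_{lk}$ on $U$ such that for every open $W\subseteq U$ and every $C^2$ solution $X=\xi^je_j$ of $L_Xg=0$ on $W$, $$e_l(e_k\,\xi^i)=\sum_jB^{ij}_{lk}\,\xi^j+\sum_{j,m}C^{ijm}_{lk}\,e_m\xi^j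 .$$ In the sense of items 2–8, the Pfaffian system $\{\theta^i,\theta^i_j\}$ with $\xi^j_k+\xi^k_j=0$ is a completely determined prolongation to second order of the Killing equation $L_Xg=0$. -/

import Mathlib

open Bundle Set VectorField
open scoped Manifold ContDiff Bundle

noncomputable section

namespace Killing

/-- (Not necessarily continuous) vector fields on an `n`-dimensional manifold `M`. A field that
is only of interest on an open set has arbitrary values elsewhere. -/
abbrev VField (n : ℕ) (M : Type*) [TopologicalSpace M]
    [ChartedSpace (EuclideanSpace ℝ (Fin n)) M] : Type _ :=
  (x : M) → TangentSpace (𝓡 n) x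

/-- (Not necessarily continuous) 1-forms on `M`. -/
abbrev Form (n : ℕ) (M : Type*) [TopologicalSpace M]
    [ChartedSpace (EuclideanSpace ℝ (Fin n)) M] : Type _ :=
  (x : M) → TangentSpace (𝓡 n) x →L[ℝ] ℝ

section Smooth

variable {n : ℕ} {M : Type*} [TopologicalSpace M] [ChartedSpace (EuclideanSpace ℝ (Fin n)) M]

/-- The vector field `X` is differentiable at `x`. -/
def FieldDiffAt [IsManifold (𝓡 n) ∞ M] (X : VField n M) (x : M) : Prop :=
  MDifferentiableAt (𝓡 n) ((𝓡 n).prod 𝓘(ℝ, EuclideanSpace ℝ (Fin n)))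
    (fun y => TotalSpace.mk' (EuclideanSpace ℝ (Fin n)) y (X y)) x

/-- The vector field `X` is smooth at `x`. -/
def FieldSmoothAt [IsManifold (𝓡 n) ∞ M] (X : VField n M) (x : M) : Prop :=
  ContMDiffAt (𝓡 n) ((𝓡 n).prod 𝓘(ℝ, EuclideanSpace ℝ (Fin n))) ∞
    (fun y => TotalSpace.mk' (EuclideanSpace ℝ (Fin n)) y (X y)) x

/-- The vector field `X` is of class `C^k` on the set `W`. -/
def FieldContDiffOn [IsManifold (𝓡 n) ∞ M] (k : ℕ∞) (X : VField n M) (W : Set M) : Prop :=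
  ContMDiffOn (𝓡 n) ((𝓡 n).prod 𝓘(ℝ, EuclideanSpace ℝ (Fin n))) k
    (fun y => TotalSpace.mk' (EuclideanSpace ℝ (Fin n)) y (X y)) W

/-- The real function `f` is smooth on the set `W`. -/
def FunSmoothOn (f : M → ℝ) (W : Set M) : Prop :=
  ContMDiffOn (𝓡 n) 𝓘(ℝ, ℝ) ∞ f W

/-- The exterior derivative of a 1-form, evaluated on two vector fields:
`dα(V, W) = V(α(W)) - W(α(V)) - α([V, W])`. -/
def extD (α : Form n M) (V W : VField n M) (x : M) : ℝ :=
  mvfderiv (𝓡 n) (fun y => α y (W y)) x (V x) - mvfderiv (𝓡 n) (fun y => α y (V y)) x (W x)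
    - α x (mlieBracket (𝓡 n) V W x)

/-- The wedge product of two 1-forms at a point, `(α ∧ β)(v, w) = α(v) β(w) - α(w) β(v)`. -/
def wedge {x : M} (α β : TangentSpace (𝓡 n) x →L[ℝ] ℝ) (v w : TangentSpace (𝓡 n) x) : ℝ :=
  α v * β w - α w * β v

/-- Two vector fields have the same 1-jet at `x`: they have the same value at `x`, and their
components in the chart around `x` have the same first derivatives at `x`. -/
def SameOneJet [IsManifold (𝓡 n) ∞ M] (x : M) (X Y : VField n M) : Prop :=
  X x = Y x ∧
  mvfderiv (𝓡 n) (fun y => (trivializationAt (EuclideanSpace ℝ (Fin n))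
      (TangentSpace (𝓡 n) : M → Type _) x ⟨y, X y⟩).2) x =
    mvfderiv (𝓡 n) (fun y => (trivializationAt (EuclideanSpace ℝ (Fin n))
      (TangentSpace (𝓡 n) : M → Type _) x ⟨y, Y y⟩).2) x

/-- The equivalence relation "same 1-jet at `x`" on vector fields that are smooth at `x`. -/
def oneJetSetoid (n : ℕ) {M : Type*} [TopologicalSpace M]
    [ChartedSpace (EuclideanSpace ℝ (Fin n)) M] [IsManifold (𝓡 n) ∞ M] (x : M) :
    Setoid {X : VField n M // FieldSmoothAt X x} where
  r X Y := SameOneJet x X.1 Y.1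
  iseqv := ⟨fun _ => ⟨rfl, rfl⟩, fun h => ⟨h.1.symm, h.2.symm⟩,
    fun h k => ⟨h.1.trans k.1, h.2.trans k.2⟩⟩

/-- The fibre over `x` of the bundle `J¹(TM)` of 1-jets of vector fields. -/
def OneJet (n : ℕ) {M : Type*} [TopologicalSpace M]
    [ChartedSpace (EuclideanSpace ℝ (Fin n)) M] [IsManifold (𝓡 n) ∞ M] (x : M) : Type _ :=
  Quotient (oneJetSetoid n x)

/-- The 1-jet at `x` of a vector field that is smooth at `x`. -/
def oneJet [IsManifold (𝓡 n) ∞ M] (x : M) (X : VField n M) (hX : FieldSmoothAt X x) :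
    OneJet n x :=
  Quotient.mk (oneJetSetoid n x) ⟨X, hX⟩

/-- The covariant derivative `∇_Y (∇X)` of the `(1,1)`-tensor `∇X`, applied to `Z`:
`(∇_Y (∇X)) Z = ∇_Y (∇_Z X) - ∇_{∇_Y Z} X`. -/
def covDerivNabla [IsManifold (𝓡 n) ∞ M]
    (cov : CovariantDerivative (𝓡 n) (EuclideanSpace ℝ (Fin n))
      (TangentSpace (𝓡 n) : M → Type _))
    (Y X Z : VField n M) (x : M) : TangentSpace (𝓡 n) x :=
  cov (fun y => cov X y (Z y)) x (Y x) - cov X x (cov Z x (Y x))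

/-- The curvature `R(X, Y) Z = ∇_X ∇_Y Z - ∇_Y ∇_X Z - ∇_{[X, Y]} Z`. -/
def curv [IsManifold (𝓡 n) ∞ M]
    (cov : CovariantDerivative (𝓡 n) (EuclideanSpace ℝ (Fin n))
      (TangentSpace (𝓡 n) : M → Type _))
    (X Y Z : VField n M) (x : M) : TangentSpace (𝓡 n) x :=
  cov (fun y => cov Z y (Y y)) x (X x) - cov (fun y => cov Z y (X y)) x (Y x)
    - cov Z x (mlieBracket (𝓡 n) X Y x)

end Smooth

section Riemannian

variable {n : ℕ} {M : Type*} [TopologicalSpace M] [ChartedSpace (EuclideanSpace ℝ (Fin n)) M]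
  [IsManifold (𝓡 n) ∞ M]
  [RiemannianBundle (fun x : M => TangentSpace (𝓡 n) x)]

/-- The Lie derivative of the metric:
`(L_X g)(Y, Z) = X(g(Y, Z)) - g([X, Y], Z) - g(Y, [X, Z])`. -/
def lieDerivMetric (X Y Z : VField n M) (x : M) : ℝ :=
  mvfderiv (𝓡 n) (fun y => inner ℝ (Y y) (Z y)) x (X x)
    - inner ℝ (mlieBracket (𝓡 n) X Y x) (Z x) - inner ℝ (Y x) (mlieBracket (𝓡 n) X Z x)

/-- The Killing equation `L_X g = 0` at the point `x`. -/
def KillingAt (X : VField n M) (x : M) : Prop :=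
  ∀ Y Z : VField n M, FieldSmoothAt Y x → FieldSmoothAt Z x → lieDerivMetric X Y Z x = 0

/-- `∇` is the Levi-Civita connection: it is torsion free and compatible with the metric. -/
def IsLeviCivita
    [IsContMDiffRiemannianBundle (𝓡 n) ∞ (EuclideanSpace ℝ (Fin n))
      (fun x : M => TangentSpace (𝓡 n) x)]
    (cov : CovariantDerivative (𝓡 n) (EuclideanSpace ℝ (Fin n))
      (TangentSpace (𝓡 n) : M → Type _)) : Prop :=
  haveI : IsContMDiffRiemannianBundle (𝓡 n) 1 (EuclideanSpace ℝ (Fin n))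
      (TangentSpace (𝓡 n) : M → Type _) :=
    IsContMDiffRiemannianBundle.of_le (n := ∞) (by simp)
  cov.torsion = 0 ∧ cov.IsMetricCompatible

/-- `e₁, …, eₙ` is a smooth orthonormal frame over `U`. -/
def IsOrthonormalFrameOn (e : Fin n → VField n M) (U : Set M) : Prop :=
  (∀ i, FieldContDiffOn ⊤ (e i) U) ∧ ∀ x ∈ U, Orthonormal ℝ (fun i => e i x)

/-- The dual coframe `ω^i` of an orthonormal frame. -/
def coframe (e : Fin n → VField n M) (i : Fin n) : Form n M :=
  fun x => innerSL ℝ (e i x)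

/-- The connection forms `ω^i_j` of the frame: `∇ e_j = ω^i_j e_i`. -/
def connForm
    (cov : CovariantDerivative (𝓡 n) (EuclideanSpace ℝ (Fin n))
      (TangentSpace (𝓡 n) : M → Type _))
    (e : Fin n → VField n M) (i j : Fin n) : Form n M :=
  fun x => (innerSL ℝ (e i x)) ∘L (cov (e j) x)

/-- The curvature coefficients `R_{ijkl} = g(R(e_k, e_l) e_j, e_i)` of the frame. -/
def curvCoeff
    (cov : CovariantDerivative (𝓡 n) (EuclideanSpace ℝ (Fin n))
      (TangentSpace (𝓡 n) : M → Type _))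
    (e : Fin n → VField n M) (i j k l : Fin n) (x : M) : ℝ :=
  inner ℝ (curv cov (e k) (e l) (e j) x) (e i x)

/-- The structure equations of an orthonormal frame over `U`: smooth 1-forms `ω^i_j` and smooth
functions `R_{ijkl}` with
`dω^i = ω^k ∧ ω^i_k`, `dω^i_j = ω^k_j ∧ ω^i_k + (1/2) R_{ijkl} ω^k ∧ ω^l`, `ω^i_j + ω^j_i = 0`,
`R_{ijkl} = -R_{ijlk}` and the first Bianchi identity. -/
structure StructureEquationsOn (e : Fin n → VField n M) (U : Set M)
    (Γ : Fin n → Fin n → Form n M) (R : Fin n → Fin n → Fin n → Fin n → M → ℝ) : Prop where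
  smooth_form : ∀ i j k, FunSmoothOn (n := n) (fun x => Γ i j x (e k x)) U
  smooth_curv : ∀ i j k l, FunSmoothOn (n := n) (R i j k l) U
  skew : ∀ x ∈ U, ∀ i j, Γ i j x + Γ j i x = 0
  first : ∀ x ∈ U, ∀ V W : VField n M, FieldSmoothAt V x → FieldSmoothAt W x → ∀ i,
    extD (coframe e i) V W x = ∑ k, wedge (coframe e k x) (Γ i k x) (V x) (W x)
  second : ∀ x ∈ U, ∀ V W : VField n M, FieldSmoothAt V x → FieldSmoothAt W x → ∀ i j,
    extD (Γ i j) V W x = ∑ k, wedge (Γ k j x) (Γ i k x) (V x) (W x)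
      + (1 / 2) * ∑ k, ∑ l, R i j k l x * wedge (coframe e k x) (coframe e l x) (V x) (W x)
  curv_skew : ∀ x ∈ U, ∀ i j k l, R i j k l x + R i j l k x = 0
  bianchi : ∀ x ∈ U, ∀ s i j k, R s i j k x + R s j k i x + R s k i j x = 0

/-- The components `ξ^i` of a vector field in an orthonormal frame. -/
def comp (e : Fin n → VField n M) (X : VField n M) (i : Fin n) (x : M) : ℝ :=
  inner ℝ (e i x) (X x)

/-- The functions `ξ^i_k` determined by `dξ^i + ξ^m ω^i_m = ξ^i_k ω^k`. -/
def jetComp (e : Fin n → VField n M) (Γ : Fin n → Fin n → Form n M) (X : VField n M)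
    (i k : Fin n) (x : M) : ℝ :=
  mvfderiv (𝓡 n) (comp e X i) x (e k x) + ∑ m, comp e X m x * Γ i m x (e k x)

/-- Tangent vectors `(v, η, α)` at a point `(x, ξ^i, ξ^i_j)` of `J¹(TM)`, in the coordinates
`(x, ξ^i, ξ^i_j)` on `J¹(TM)`: thus `v` is tangent to `M`, `η i = dξ^i` and `α i j = dξ^i_j`. -/
abbrev JetTangent (n : ℕ) {M : Type*} [TopologicalSpace M]
    [ChartedSpace (EuclideanSpace ℝ (Fin n)) M] (x : M) : Type _ :=
  TangentSpace (𝓡 n) x × (Fin n → ℝ) × (Fin n → Fin n → ℝ)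

/-- The 1-form `θ^i = dξ^i + ξ^k ω^i_k - ξ^i_k ω^k` on `J¹(TM)` at the point
`(x, ξ^i, ξ^i_j) = (x, ξ, a)`. -/
def theta₁ (e : Fin n → VField n M) (Γ : Fin n → Fin n → Form n M)
    (x : M) (ξ : Fin n → ℝ) (a : Fin n → Fin n → ℝ) (i : Fin n) :
    JetTangent n x →ₗ[ℝ] ℝ where
  toFun w := w.2.1 i + ∑ k, ξ k * Γ i k x w.1 - ∑ k, a i k * coframe e k x w.1
  map_add' u w := by
    simp only [Prod.fst_add, Prod.snd_add, Pi.add_apply, map_add, mul_add,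
      Finset.sum_add_distrib]
    ring
  map_smul' c w := by
    simp only [Prod.smul_fst, Prod.smul_snd, Pi.smul_apply, map_smul, smul_eq_mul,
      RingHom.id_apply, mul_sub, mul_add, Finset.mul_sum, mul_left_comm]

/-- The 1-form `θ^i_j = dξ^i_j - ξ^i_k ω^k_j + ξ^k_j ω^i_k + ξ^k R_{ijkl} ω^l` on `J¹(TM)` at the
point `(x, ξ^i, ξ^i_j) = (x, ξ, a)`. -/
def theta₂ (e : Fin n → VField n M) (Γ : Fin n → Fin n → Form n M)
    (R : Fin n → Fin n → Fin n → Fin n → M → ℝ)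
    (x : M) (ξ : Fin n → ℝ) (a : Fin n → Fin n → ℝ) (i j : Fin n) :
    JetTangent n x →ₗ[ℝ] ℝ where
  toFun w := w.2.2 i j - ∑ k, a i k * Γ k j x w.1 + ∑ k, a k j * Γ i k x w.1
    + ∑ k, ∑ l, ξ k * R i j k l x * coframe e l x w.1
  map_add' u w := by
    simp only [Prod.fst_add, Prod.snd_add, Pi.add_apply, map_add, mul_add,
      Finset.sum_add_distrib]
    ring
  map_smul' c w := by
    simp only [Prod.smul_fst, Prod.smul_snd, Pi.smul_apply, map_smul, smul_eq_mul,
      RingHom.id_apply, mul_sub, mul_add, Finset.mul_sum, mul_left_comm]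

/-- The skew-symmetry `ξ^j_k + ξ^k_j = 0`. -/
def Skew (a : Fin n → Fin n → ℝ) : Prop := ∀ j k, a j k + a k j = 0

/-- The derivative at `x` of the section `y ↦ (y, ξ^i(y), ξ^i_j(y))` of `J¹(TM)`. -/
def sectionDeriv (ξ : Fin n → M → ℝ) (a : Fin n → Fin n → M → ℝ) (x : M)
    (v : TangentSpace (𝓡 n) x) : JetTangent n x :=
  (v, fun i => mvfderiv (𝓡 n) (ξ i) x v, fun i j => mvfderiv (𝓡 n) (a i j) x v)

/-- The pullbacks of all `θ^i` and `θ^i_j` by the section `y ↦ (y, ξ^i(y), ξ^i_j(y))` of `J¹(TM)`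
vanish at `x`. -/
def PfaffAt (e : Fin n → VField n M) (Γ : Fin n → Fin n → Form n M)
    (R : Fin n → Fin n → Fin n → Fin n → M → ℝ)
    (ξ : Fin n → M → ℝ) (a : Fin n → Fin n → M → ℝ) (x : M) : Prop :=
  ∀ v : TangentSpace (𝓡 n) x,
    (∀ i, theta₁ e Γ x (fun k => ξ k x) (fun k l => a k l x) i (sectionDeriv ξ a x v) = 0) ∧
    ∀ i j, theta₂ e Γ R x (fun k => ξ k x) (fun k l => a k l x) i j (sectionDeriv ξ a x v) = 0

end Riemannian

end Killing

end

/-! All computations take place in the orthonormal frame. The Koszul formula is tensorial in the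
direction and in the test field, so it defines a connection, which is metric and torsion free. In
the frame, metric compatibility is the skewness of ω^i_j, vanishing torsion is the first structure
equation, and the curvature formula is the second one; the first Bianchi identity is the Jacobi
identity rewritten with `∇`. Uniqueness is the fact that a three-index array skew in one pair and
symmetric in an overlapping pair vanishes.

The functions ξ^i_k are the components of `∇X`, so `L_X g = 0` says that `∇X` is skew. The forms θ^i
vanish on every section that is a 1-jet and, conversely, force a section to be one. On the 1-jet of
`X`, the form θ^i_j becomes the corresponding component of `∇_Y(∇X) - R(Y, X)`
(`inner_covDerivNabla_sub_curv`). It remains to prove Kostant's identity `∇_Y(∇X) = R(Y, X)` for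
Killing fields, and this is algebra (`eq_neg_of_skew_of_ricci`). The second covariant derivative
P_{ikl} is skew in i, k, since `X` is Killing near the point, and its skew part in k, l is curvature
by the Ricci identity. Three cyclic instances solve for P; pair symmetry and Bianchi reduce the
result to one curvature term.

Each θ^i, θ^i_j contains dξ^i, dξ^i_j with coefficient one, so lifts of tangent vectors exist and
are unique. They stay tangent to the skew locus because ω^i_j and R_{ijkl} are skew in i, j. Solving
θ^i_k = 0 for the derivatives of ξ^i_k gives the second derivatives of a Killing field. -/

noncomputable section

namespace Killing

open scoped Topology

/-! ### Extending tangent vectors to fields -/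

section Fields

variable {n : ℕ} {M : Type*} [TopologicalSpace M] [ChartedSpace (EuclideanSpace ℝ (Fin n)) M]

instance (x : M) : FiniteDimensional ℝ (TangentSpace (𝓡 n) x) :=
  inferInstanceAs (FiniteDimensional ℝ (EuclideanSpace ℝ (Fin n)))

theorem finrank_tangentSpace (x : M) : Module.finrank ℝ (TangentSpace (𝓡 n) x) = n :=
  (finrank_euclideanSpace_fin : Module.finrank ℝ (EuclideanSpace ℝ (Fin n)) = n)

variable [IsManifold (𝓡 n) ∞ M] {X Y : VField n M} {x : M}

theorem exists_fieldDiffAt (v : TangentSpace (𝓡 n) x) :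
    ∃ X : VField n M, FieldDiffAt X x ∧ X x = v :=
  ⟨FiberBundle.extend (EuclideanSpace ℝ (Fin n)) v,
    FiberBundle.mdifferentiableAt_extend .., by simp⟩

theorem FieldDiffAt.add (hX : FieldDiffAt X x) (hY : FieldDiffAt Y x) : FieldDiffAt (X + Y) x :=
  mdifferentiableAt_add_section hX hY

theorem FieldDiffAt.smul {f : M → ℝ} (hf : MDifferentiableAt (𝓡 n) 𝓘(ℝ, ℝ) f x)
    (hX : FieldDiffAt X x) : FieldDiffAt (f • X) x :=
  MDifferentiableAt.smul_section hf hX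

variable [RiemannianBundle (fun x : M => TangentSpace (𝓡 n) x)]

theorem ext_inner_fields {L L' : TangentSpace (𝓡 n) x →L[ℝ] TangentSpace (𝓡 n) x}
    (h : ∀ Y Z : VField n M, FieldDiffAt Y x → FieldDiffAt Z x →
      inner ℝ (L (Y x)) (Z x) = (inner ℝ (L' (Y x)) (Z x) : ℝ)) : L = L' := by
  ext1 v
  refine ext_inner_right ℝ fun w => ?_
  obtain ⟨Y, hY, rfl⟩ := exists_fieldDiffAt v
  obtain ⟨Z, hZ, rfl⟩ := exists_fieldDiffAt w
  exact h Y Z hY hZ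

end Fields

/-! ### Existence of the Levi-Civita connection -/

section LeviCivita

variable {n : ℕ} {M : Type*} [TopologicalSpace M] [ChartedSpace (EuclideanSpace ℝ (Fin n)) M]
  [IsManifold (𝓡 n) ∞ M]
  [RiemannianBundle (fun x : M => TangentSpace (𝓡 n) x)]
  [IsContMDiffRiemannianBundle (𝓡 n) ∞ (EuclideanSpace ℝ (Fin n))
      (fun x : M => TangentSpace (𝓡 n) x)]

/-- The right-hand side of the Koszul formula for `2 g(∇_Y X, Z)`. -/
def koszul (X Y Z : VField n M) (x : M) : ℝ :=
  mvfderiv (𝓡 n) (fun y => inner ℝ (X y) (Z y)) x (Y x)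
    + mvfderiv (𝓡 n) (fun y => inner ℝ (Z y) (Y y)) x (X x)
    - mvfderiv (𝓡 n) (fun y => inner ℝ (Y y) (X y)) x (Z x)
    + inner ℝ (mlieBracket (𝓡 n) Y X x) (Z x)
    - inner ℝ (mlieBracket (𝓡 n) X Z x) (Y x)
    + inner ℝ (mlieBracket (𝓡 n) Z Y x) (X x)

variable {X Y Z X' : VField n M} {x : M}

theorem isContMDiffRiemannianBundle_of_le (k : ℕ∞) :
    IsContMDiffRiemannianBundle (𝓡 n) k (EuclideanSpace ℝ (Fin n))
      (TangentSpace (𝓡 n) : M → Type _) :=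
  IsContMDiffRiemannianBundle.of_le (n := ∞) (by exact_mod_cast le_top)

theorem FieldDiffAt.inner (hX : FieldDiffAt X x) (hY : FieldDiffAt Y x) :
    MDifferentiableAt (𝓡 n) 𝓘(ℝ, ℝ) (fun y => inner ℝ (X y) (Y y)) x :=
  have : IsContMDiffRiemannianBundle (𝓡 n) 1 (EuclideanSpace ℝ (Fin n))
      (TangentSpace (𝓡 n) : M → Type _) := isContMDiffRiemannianBundle_of_le 1
  MDifferentiableAt.inner_bundle hX hY

/-- When the argument is scaled by `f`, the derivatives of `f` from the two differentiated inner
products containing it cancel those from the two brackets containing it. -/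
theorem koszul_tensorial_left (hX : FieldDiffAt X x) (Z : VField n M) (hZ : FieldDiffAt Z x) :
    TensorialAt (𝓡 n) (EuclideanSpace ℝ (Fin n)) (fun Y => koszul X Y Z x) x where
  smul {f Y} hf hY := by
    have h1 : FieldDiffAt Y x := hY
    simp only [koszul, Pi.smul_apply', real_inner_smul_left, real_inner_smul_right, map_smul,
      mvfderiv_fun_mul hf (hZ.inner h1), mvfderiv_fun_mul hf (h1.inner hX), inner_add_left,
      mlieBracket_smul_left hf hY, mlieBracket_smul_right hf hY, add_apply, smul_apply,
      smul_eq_mul]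
    rw [real_inner_comm (Y x) (Z x)]
    ring
  add {Y Y'} hY hY' := by
    have h1 : FieldDiffAt Y x := hY
    have h2 : FieldDiffAt Y' x := hY'
    simp only [koszul, Pi.add_apply, inner_add_left, inner_add_right, map_add,
      mvfderiv_fun_add (hZ.inner h1) (hZ.inner h2), mvfderiv_fun_add (h1.inner hX) (h2.inner hX),
      mlieBracket_add_left hY hY', mlieBracket_add_right hY hY', add_apply]
    ring

theorem koszul_tensorial_right (hX : FieldDiffAt X x) (Y : VField n M) (hY : FieldDiffAt Y x) :
    TensorialAt (𝓡 n) (EuclideanSpace ℝ (Fin n)) (fun Z => koszul X Y Z x) x where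
  smul {f Z} hf hZ := by
    have h1 : FieldDiffAt Z x := hZ
    simp only [koszul, Pi.smul_apply', real_inner_smul_left, real_inner_smul_right, map_smul,
      mvfderiv_fun_mul hf (hX.inner h1), mvfderiv_fun_mul hf (h1.inner hY), inner_add_left,
      mlieBracket_smul_left hf hZ, mlieBracket_smul_right hf hZ, add_apply, smul_apply,
      smul_eq_mul]
    rw [real_inner_comm (Z x) (X x)]
    ring
  add {Z Z'} hZ hZ' := by
    have h1 : FieldDiffAt Z x := hZ
    have h2 : FieldDiffAt Z' x := hZ'
    simp only [koszul, Pi.add_apply, inner_add_left, inner_add_right, map_add,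
      mvfderiv_fun_add (hX.inner h1) (hX.inner h2), mvfderiv_fun_add (h1.inner hY) (h2.inner hY),
      mlieBracket_add_left hZ hZ', mlieBracket_add_right hZ hZ', add_apply]
    ring

/-- The bilinear form `(Y, Z) ↦ 2 g(∇_Y X, Z)` at a point where `X` is differentiable. -/
def koszulForm (hX : FieldDiffAt X x) :
    TangentSpace (𝓡 n) x →L[ℝ] TangentSpace (𝓡 n) x →L[ℝ] ℝ :=
  TensorialAt.mkHom₂ (F := EuclideanSpace ℝ (Fin n)) (F' := EuclideanSpace ℝ (Fin n))
    (fun Y Z => koszul X Y Z x) x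
    (koszul_tensorial_left hX) (koszul_tensorial_right hX)

theorem koszulForm_apply (hX : FieldDiffAt X x) (hY : FieldDiffAt Y x) (hZ : FieldDiffAt Z x) :
    koszulForm hX (Y x) (Z x) = koszul X Y Z x :=
  TensorialAt.mkHom₂_apply _ _ hY hZ

open Classical in
/-- The Levi-Civita connection as a function on vector fields. -/
def lcFun (X : VField n M) (x : M) : TangentSpace (𝓡 n) x →L[ℝ] TangentSpace (𝓡 n) x :=
  if hX : FieldDiffAt X x then
    LinearMap.toContinuousLinearMap
      { toFun := fun v => (InnerProductSpace.toDual ℝ (TangentSpace (𝓡 n) x)).symm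
          ((1 / 2 : ℝ) • koszulForm hX v)
        map_add' := fun v w => by simp
        map_smul' := fun c v => by simp [smul_comm c] }
  -- The axioms of a covariant derivative only concern fields differentiable at the point, so the
  -- value here is free.
  else 0

theorem inner_lcFun (hX : FieldDiffAt X x) (hY : FieldDiffAt Y x) (hZ : FieldDiffAt Z x) :
    inner ℝ (lcFun X x (Y x)) (Z x) = 1 / 2 * koszul X Y Z x := by
  rw [lcFun, dif_pos hX]
  change inner ℝ ((InnerProductSpace.toDual ℝ (TangentSpace (𝓡 n) x)).symm
    ((1 / 2 : ℝ) • koszulForm hX (Y x))) (Z x) = _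
  rw [InnerProductSpace.toDual_symm_apply, smul_apply, koszulForm_apply hX hY hZ, smul_eq_mul]

/-- For the Leibniz rule, `Y(f) g(X, Z)` arises twice, once from the differentiated inner product
and once from `[Y, fX]`, which the factor 1/2 absorbs; the terms with `Z(f)` cancel. -/
theorem isCovariantDerivativeOn_lcFun :
    IsCovariantDerivativeOn (I := 𝓡 n) (M := M) (V := TangentSpace (𝓡 n))
      (EuclideanSpace ℝ (Fin n)) lcFun univ where
  add {X X' x} hX hX' _ := by
    have h1 : FieldDiffAt X x := hX
    have h2 : FieldDiffAt X' x := hX'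
    refine ext_inner_fields fun Y Z hY hZ => ?_
    rw [inner_lcFun (h1.add h2) hY hZ, add_apply, inner_add_left,
      inner_lcFun h1 hY hZ, inner_lcFun h2 hY hZ]
    simp only [koszul, Pi.add_apply, inner_add_left, inner_add_right, map_add,
      mvfderiv_fun_add (hY.inner h1) (hY.inner h2), mvfderiv_fun_add (h1.inner hZ) (h2.inner hZ),
      mlieBracket_add_left hX hX', mlieBracket_add_right hX hX', add_apply]
    ring
  leibniz {X f x} hX hf _ := by
    have h1 : FieldDiffAt X x := hX
    refine ext_inner_fields fun Y Z hY hZ => ?_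
    rw [inner_lcFun (h1.smul hf) hY hZ, add_apply, inner_add_left, smul_apply,
      real_inner_smul_left, inner_lcFun h1 hY hZ, ContinuousLinearMap.smulRight_apply,
      real_inner_smul_left]
    simp only [koszul, Pi.smul_apply', real_inner_smul_left, real_inner_smul_right, map_smul,
      mvfderiv_fun_mul hf (hY.inner h1), mvfderiv_fun_mul hf (h1.inner hZ), inner_add_left,
      mlieBracket_smul_left hf hX, mlieBracket_smul_right hf hX, add_apply, smul_apply,
      smul_eq_mul]
    rw [real_inner_comm (Y x) (X x)]
    ring

variable (n M) in
/-- The Levi-Civita connection. -/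
def leviCivita : CovariantDerivative (𝓡 n) (EuclideanSpace ℝ (Fin n))
    (TangentSpace (𝓡 n) : M → Type _) :=
  ⟨lcFun, isCovariantDerivativeOn_lcFun⟩

/-- Antisymmetrizing the Koszul expression in the differentiated field and the direction leaves
twice a bracket term. Symmetrizing it in the differentiated field and the test field leaves twice
the derivative of their inner product. -/
theorem isLeviCivita_leviCivita : IsLeviCivita (leviCivita n M) := by
  have : IsContMDiffRiemannianBundle (𝓡 n) 1 (EuclideanSpace ℝ (Fin n))
      (TangentSpace (𝓡 n) : M → Type _) := isContMDiffRiemannianBundle_of_le 1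
  refine ⟨?_, ?_⟩
  · rw [CovariantDerivative.torsion_eq_zero_iff]
    intro X Y x hX hY
    refine ext_inner_right ℝ fun w => ?_
    obtain ⟨Z, hZ, rfl⟩ := exists_fieldDiffAt w
    change inner ℝ (lcFun Y x (X x) - lcFun X x (Y x)) (Z x) = _
    rw [inner_sub_left, inner_lcFun hX hY hZ, inner_lcFun hY hX hZ]
    simp only [koszul, real_inner_comm]
    rw [mlieBracket_swap_apply (V := Y) (W := X), mlieBracket_swap_apply (V := Y) (W := Z),
      mlieBracket_swap_apply (V := Z) (W := X)]
    simp only [inner_neg_right]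
    ring
  · rw [CovariantDerivative.isMetricCompatible_iff]
    intro x X Y Z hX hY hZ
    change mvfderiv (𝓡 n) (fun y => inner ℝ (Y y) (Z y)) x (X x) =
      inner ℝ (lcFun Y x (X x)) (Z x) + inner ℝ (Y x) (lcFun Z x (X x))
    rw [real_inner_comm _ (Y x), inner_lcFun hY hX hZ, inner_lcFun hZ hX hY]
    simp only [koszul, real_inner_comm]
    rw [mlieBracket_swap_apply (V := Y) (W := X), mlieBracket_swap_apply (V := Y) (W := Z),
      mlieBracket_swap_apply (V := Z) (W := X)]
    simp only [inner_neg_right]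
    ring

end LeviCivita

/-! ### Pointwise calculus of functions and vector fields -/

section Calculus

variable {n : ℕ} {M : Type*} [TopologicalSpace M] [ChartedSpace (EuclideanSpace ℝ (Fin n)) M]

/-- The real function `f` is of class `C^k` at `x`. -/
def FunContDiffAt (k : ℕ∞) (f : M → ℝ) (x : M) : Prop :=
  ContMDiffAt (𝓡 n) 𝓘(ℝ, ℝ) k f x

/-- The derivative of the function `f` along the vector field `V`. -/
def dirDeriv (V : VField n M) (f : M → ℝ) (y : M) : ℝ := mvfderiv (𝓡 n) f y (V y)

variable {k l : ℕ∞} {f g : M → ℝ} {x : M}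

theorem FunContDiffAt.of_le (hf : FunContDiffAt (n := n) k f x) (h : l ≤ k) :
    FunContDiffAt (n := n) l f x :=
  ContMDiffAt.of_le hf (by exact_mod_cast h)

theorem FunContDiffAt.mdifferentiableAt (hf : FunContDiffAt (n := n) k f x) (h : 1 ≤ k) :
    MDifferentiableAt (𝓡 n) 𝓘(ℝ, ℝ) f x :=
  ContMDiffAt.mdifferentiableAt (hf.of_le h) one_ne_zero

theorem FunContDiffAt.add (hf : FunContDiffAt (n := n) k f x) (hg : FunContDiffAt (n := n) k g x) :
    FunContDiffAt (n := n) k (fun y => f y + g y) x := ContMDiffAt.add hf hg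

theorem FunContDiffAt.sub (hf : FunContDiffAt (n := n) k f x) (hg : FunContDiffAt (n := n) k g x) :
    FunContDiffAt (n := n) k (fun y => f y - g y) x := ContMDiffAt.sub hf hg

theorem FunContDiffAt.mul (hf : FunContDiffAt (n := n) k f x) (hg : FunContDiffAt (n := n) k g x) :
    FunContDiffAt (n := n) k (fun y => f y * g y) x := ContMDiffAt.mul hf hg

theorem FunContDiffAt.const (c : ℝ) : FunContDiffAt (n := n) k (fun _ : M => c) x :=
  contMDiffAt_const

theorem FunContDiffAt.sum {ι : Type*} {s : Finset ι} {f : ι → M → ℝ}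
    (hf : ∀ i ∈ s, FunContDiffAt (n := n) k (f i) x) :
    FunContDiffAt (n := n) k (fun y => ∑ i ∈ s, f i y) x :=
  ContMDiffAt.sum hf

theorem FunContDiffAt.congr (hf : FunContDiffAt (n := n) k f x) (h : g =ᶠ[𝓝 x] f) :
    FunContDiffAt (n := n) k g x :=
  ContMDiffAt.congr_of_eventuallyEq hf h

theorem mvfderiv_congr {F : Type*} [NormedAddCommGroup F] [NormedSpace ℝ F] {f g : M → F}
    (h : f =ᶠ[𝓝 x] g) : mvfderiv (𝓡 n) f x = mvfderiv (𝓡 n) g x := by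
  have := h.mfderiv_eq (I := 𝓡 n) (I' := 𝓘(ℝ, F))
  ext v
  simp only [mvfderiv, this]
  rfl

theorem hasDeriv_finset_sum {F : Type*} [NormedAddCommGroup F] [NormedSpace ℝ F]
    {ι : Type*} {s : Finset ι} {f : ι → M → F}
    (hf : ∀ i ∈ s, MDifferentiableAt (𝓡 n) 𝓘(ℝ, F) (f i) x) :
    MDifferentiableAt (𝓡 n) 𝓘(ℝ, F) (fun y => ∑ i ∈ s, f i y) x ∧
      mvfderiv (𝓡 n) (fun y => ∑ i ∈ s, f i y) x = ∑ i ∈ s, mvfderiv (𝓡 n) (f i) x := by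
  classical
  induction s using Finset.induction_on with
  | empty => simpa [mvfderiv_const] using mdifferentiableAt_const
  | insert a s ha ih =>
    have h1 := hf a (Finset.mem_insert_self a s)
    obtain ⟨h2, h3⟩ := ih fun i hi => hf i (Finset.mem_insert_of_mem hi)
    simp only [Finset.sum_insert ha]
    exact ⟨h1.add h2, by rw [mvfderiv_fun_add h1 h2, h3]⟩

/-- Covers dimension zero, where there is no frame field to use in the bracket arguments below. -/
theorem dirDeriv_of_isEmpty [IsEmpty (Fin n)] (V : VField n M) (f : M → ℝ) :
    dirDeriv V f = fun _ => 0 := by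
  funext y
  have : V y = 0 := by
    have := Module.finrank_zero_iff (R := ℝ) (M := TangentSpace (𝓡 n) y)
    rw [finrank_tangentSpace] at this
    have h0 : n = 0 := by
      rw [← Fintype.card_fin n]; exact Fintype.card_eq_zero
    exact (this.1 h0).elim _ _
  rw [dirDeriv, this, map_zero]

variable [IsManifold (𝓡 n) ∞ M] {X Y V W : VField n M}

/-- The vector field `X` is of class `C^k` at `x`. -/
def FieldContDiffAt (k : ℕ∞) (X : VField n M) (x : M) : Prop :=
  ContMDiffAt (𝓡 n) ((𝓡 n).prod 𝓘(ℝ, EuclideanSpace ℝ (Fin n))) k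
    (fun y => TotalSpace.mk' (EuclideanSpace ℝ (Fin n)) y (X y)) x

theorem FieldContDiffAt.of_le (hX : FieldContDiffAt k X x) (h : l ≤ k) : FieldContDiffAt l X x :=
  ContMDiffAt.of_le hX (by exact_mod_cast h)

theorem FieldContDiffAt.fieldDiffAt (hX : FieldContDiffAt k X x) (h : 1 ≤ k) : FieldDiffAt X x :=
  ContMDiffAt.mdifferentiableAt (hX.of_le h) one_ne_zero

theorem FieldSmoothAt.fieldContDiffAt (hX : FieldSmoothAt X x) : FieldContDiffAt ⊤ X x := hX

theorem FieldSmoothAt.fieldDiffAt (hX : FieldSmoothAt X x) : FieldDiffAt X x :=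
  hX.fieldContDiffAt.fieldDiffAt le_top

theorem FieldContDiffAt.smul (hf : FunContDiffAt (n := n) k f x) (hX : FieldContDiffAt k X x) :
    FieldContDiffAt k (f • X) x :=
  ContMDiffAt.smul_section hf hX

theorem FieldContDiffAt.sum_smul {ι : Type*} {s : Finset ι} {f : ι → M → ℝ} {X : ι → VField n M}
    (hf : ∀ i, FunContDiffAt (n := n) k (f i) x) (hX : ∀ i, FieldContDiffAt k (X i) x) :
    FieldContDiffAt k (fun y => ∑ i ∈ s, f i y • X i y) x :=
  ContMDiffAt.sum_section fun i _ => ContMDiffAt.smul_section (hf i) (hX i)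

theorem FieldContDiffAt.congr (hX : FieldContDiffAt k X x) (h : ∀ᶠ y in 𝓝 x, Y y = X y) :
    FieldContDiffAt k Y x :=
  ContMDiffAt.congr_of_eventuallyEq hX (h.mono fun y hy => by simp only [hy])

theorem FieldDiffAt.congr (hX : FieldDiffAt X x) (h : ∀ᶠ y in 𝓝 x, Y y = X y) :
    FieldDiffAt Y x :=
  MDifferentiableAt.congr_of_eventuallyEq hX (h.mono fun y hy => by simp only [hy])

theorem cov_congr (cov : CovariantDerivative (𝓡 n) (EuclideanSpace ℝ (Fin n))
      (TangentSpace (𝓡 n) : M → Type _)) (hX : FieldDiffAt X x) (h : ∀ᶠ y in 𝓝 x, Y y = X y) :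
    cov Y x = cov X x :=
  cov.isCovariantDerivativeOn.congr_of_eventuallyEq (hX.congr h) hX Filter.univ_mem h

theorem FieldContDiffAt.mlieBracket (hV : FieldContDiffAt (k + 1) V x)
    (hW : FieldContDiffAt (k + 1) W x) : FieldContDiffAt k (mlieBracket (𝓡 n) V W) x := by
  have : IsManifold (𝓡 n) (((k + 1 : ℕ∞) : WithTop ℕ∞) + 1) M :=
    IsManifold.of_le (n := ∞) (by exact_mod_cast le_top)
  have : IsManifold (𝓡 n) (minSmoothness ℝ 2) M := by
    rw [minSmoothness_of_isRCLikeNormedField]; infer_instance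
  exact ContMDiffAt.mlieBracket_vectorField (n := k + 1) hV hW (by simp)

theorem FieldContDiffAt.eventually_fieldDiffAt (hX : FieldContDiffAt k X x) (h : 1 ≤ k) :
    ∀ᶠ y in 𝓝 x, FieldDiffAt X y :=
  ((contMDiffAt_iff_contMDiffAt_nhds (n := 1) (by simp)).1 (hX.of_le h)).mono
    fun _ hy => ContMDiffAt.mdifferentiableAt hy one_ne_zero

theorem FunContDiffAt.eventually_mdifferentiableAt (hf : FunContDiffAt (n := n) k f x)
    (h : 1 ≤ k) : ∀ᶠ y in 𝓝 x, MDifferentiableAt (𝓡 n) 𝓘(ℝ, ℝ) f y :=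
  ((contMDiffAt_iff_contMDiffAt_nhds (n := 1) (by simp)).1 (hf.of_le h)).mono
    fun _ hy => ContMDiffAt.mdifferentiableAt hy one_ne_zero

/-- Through this Leibniz rule, facts about brackets of fields become facts about derivatives of
functions. It holds on a neighbourhood so that it can be differentiated again. -/
theorem mlieBracket_smul_section_eventually (V : VField n M) (hf : FunContDiffAt (n := n) k f x)
    (hW : FieldContDiffAt k W x) (h : 1 ≤ k) :
    ∀ᶠ y in 𝓝 x, mlieBracket (𝓡 n) V (f • W) y =
      dirDeriv V f y • W y + f y • mlieBracket (𝓡 n) V W y := by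
  filter_upwards [hf.eventually_mdifferentiableAt h, hW.eventually_fieldDiffAt h] with y h1 h2
  exact mlieBracket_smul_right h1 h2

end Calculus

/-! ### Orthonormal frames and derivatives of functions along fields -/

section Riemannian

variable {n : ℕ} {M : Type*} [TopologicalSpace M] [ChartedSpace (EuclideanSpace ℝ (Fin n)) M]
  [IsManifold (𝓡 n) ∞ M]
  [RiemannianBundle (fun x : M => TangentSpace (𝓡 n) x)]
  {e : Fin n → VField n M} {U : Set M} {k : ℕ∞} {x : M} {X Y V W : VField n M} {f : M → ℝ}

theorem IsOrthonormalFrameOn.contDiffAt (he : IsOrthonormalFrameOn e U) (hU : IsOpen U)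
    (hx : x ∈ U) (i : Fin n) : FieldContDiffAt k (e i) x :=
  FieldContDiffAt.of_le (k := ⊤) (ContMDiffOn.contMDiffAt (he.1 i) (hU.mem_nhds hx)) le_top

theorem IsOrthonormalFrameOn.fieldDiffAt (he : IsOrthonormalFrameOn e U) (hU : IsOpen U)
    (hx : x ∈ U) (i : Fin n) : FieldDiffAt (e i) x :=
  (he.contDiffAt (k := 1) hU hx i).fieldDiffAt le_rfl

theorem IsOrthonormalFrameOn.inner_eq (he : IsOrthonormalFrameOn e U) (hx : x ∈ U) (i j : Fin n) :
    inner ℝ (e i x) (e j x) = if i = j then (1 : ℝ) else 0 :=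
  orthonormal_iff_ite.1 (he.2 x hx) i j

theorem IsOrthonormalFrameOn.sum_inner_smul (he : IsOrthonormalFrameOn e U) (hx : x ∈ U)
    (v : TangentSpace (𝓡 n) x) : ∑ i, (inner ℝ (e i x) v : ℝ) • e i x = v := by
  have hs : Submodule.span ℝ (range fun i => e i x) = ⊤ :=
    (he.2 x hx).linearIndependent.span_eq_top_of_card_eq_finrank'
      (by rw [finrank_tangentSpace, Fintype.card_fin])
  let b := OrthonormalBasis.mk (he.2 x hx) hs.ge
  have := b.sum_repr' v
  simpa [b] using this

theorem IsOrthonormalFrameOn.ext (he : IsOrthonormalFrameOn e U) (hx : x ∈ U)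
    {v w : TangentSpace (𝓡 n) x} (h : ∀ i, (inner ℝ (e i x) v : ℝ) = inner ℝ (e i x) w) :
    v = w := by
  rw [← he.sum_inner_smul hx v, ← he.sum_inner_smul hx w]
  simp only [h]

theorem IsOrthonormalFrameOn.map_eq_sum {F : Type*} [AddCommGroup F] [Module ℝ F]
    (he : IsOrthonormalFrameOn e U) (hx : x ∈ U) (L : TangentSpace (𝓡 n) x →ₗ[ℝ] F)
    (v : TangentSpace (𝓡 n) x) : L v = ∑ i, (inner ℝ (e i x) v : ℝ) • L (e i x) := by
  conv_lhs => rw [← he.sum_inner_smul hx v]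
  simp

theorem IsOrthonormalFrameOn.comp_sum (he : IsOrthonormalFrameOn e U) (hx : x ∈ U)
    (ξ : Fin n → M → ℝ) (i : Fin n) : comp e (fun y => ∑ j, ξ j y • e j y) i x = ξ i x := by
  simp [comp, inner_sum, real_inner_smul_right, he.inner_eq hx]

theorem IsOrthonormalFrameOn.sum_comp_smul (he : IsOrthonormalFrameOn e U) (hx : x ∈ U)
    (X : VField n M) : ∑ i, comp e X i x • e i x = X x :=
  he.sum_inner_smul hx (X x)

theorem IsOrthonormalFrameOn.fieldContDiffAt (he : IsOrthonormalFrameOn e U) (hU : IsOpen U)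
    (hx : x ∈ U) (h : ∀ i, FunContDiffAt (n := n) k (comp e X i) x) : FieldContDiffAt k X x :=
  (FieldContDiffAt.sum_smul (s := Finset.univ) h fun i => he.contDiffAt hU hx i).congr <| by
    filter_upwards [hU.mem_nhds hx] with y hy using (he.sum_comp_smul hy X).symm

variable [IsContMDiffRiemannianBundle (𝓡 n) ∞ (EuclideanSpace ℝ (Fin n))
    (fun x : M => TangentSpace (𝓡 n) x)]

theorem FieldContDiffAt.inner (hX : FieldContDiffAt k X x) (hY : FieldContDiffAt k Y x) :
    FunContDiffAt (n := n) k (fun y => inner ℝ (X y) (Y y)) x :=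
  have : IsContMDiffRiemannianBundle (𝓡 n) k (EuclideanSpace ℝ (Fin n))
      (TangentSpace (𝓡 n) : M → Type _) := isContMDiffRiemannianBundle_of_le k
  ContMDiffAt.inner_bundle hX hY

theorem IsOrthonormalFrameOn.comp_contDiffAt (he : IsOrthonormalFrameOn e U) (hU : IsOpen U)
    (hx : x ∈ U) (hX : FieldContDiffAt k X x) (i : Fin n) :
    FunContDiffAt (n := n) k (comp e X i) x :=
  (he.contDiffAt hU hx i).inner hX

theorem IsOrthonormalFrameOn.comp_mdifferentiableAt (he : IsOrthonormalFrameOn e U) (hU : IsOpen U)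
    (hx : x ∈ U) (hX : FieldDiffAt X x) (i : Fin n) :
    MDifferentiableAt (𝓡 n) 𝓘(ℝ, ℝ) (comp e X i) x :=
  (he.fieldDiffAt hU hx i).inner hX

/-- Pairing `[V, f e_i] = (V f) e_i + f [V, e_i]` with the unit field `e_i` isolates `V f`, so the
regularity of brackets passes to functions. The extra derivative asked of `V` is removed later by
expanding `V` in the frame. -/
theorem IsOrthonormalFrameOn.dirDeriv_contDiffAt (he : IsOrthonormalFrameOn e U) (hU : IsOpen U)
    (hx : x ∈ U) (hV : FieldContDiffAt (k + 1) V x) (hf : FunContDiffAt (n := n) (k + 1) f x) :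
    FunContDiffAt (n := n) k (dirDeriv V f) x := by
  rcases isEmpty_or_nonempty (Fin n) with h | ⟨⟨i⟩⟩
  · rw [dirDeriv_of_isEmpty]; exact FunContDiffAt.const 0
  have hei := he.contDiffAt (k := k + 1) hU hx i
  have hek := he.contDiffAt (k := k) hU hx i
  have h1 := hek.inner (hV.mlieBracket (FieldContDiffAt.smul hf hei))
  have h2 := (hf.of_le le_self_add).mul (hek.inner (hV.mlieBracket hei))
  refine (h1.sub h2).congr ?_
  filter_upwards [mlieBracket_smul_section_eventually V hf hei le_add_self, hU.mem_nhds hx]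
    with y hy hyU
  rw [hy, inner_add_right, real_inner_smul_right, real_inner_smul_right, he.inner_eq hyU]
  simp

/-- The Jacobi identity for `V, W, f • Z`, with `Z` a unit frame field, is compared with `f` times
the one for `V, W, Z`. The mixed terms cancel, and the coefficient of `Z` is the claim. -/
theorem IsOrthonormalFrameOn.dirDeriv_mlieBracket (he : IsOrthonormalFrameOn e U) (hU : IsOpen U)
    (hx : x ∈ U) (hV : FieldContDiffAt 2 V x) (hW : FieldContDiffAt 2 W x)
    (hf : FunContDiffAt (n := n) 2 f x) :
    dirDeriv V (dirDeriv W f) x - dirDeriv W (dirDeriv V f) x =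
      mvfderiv (𝓡 n) f x (mlieBracket (𝓡 n) V W x) := by
  rcases isEmpty_or_nonempty (Fin n) with h | ⟨⟨i⟩⟩
  · change _ = dirDeriv (mlieBracket (𝓡 n) V W) f x
    simp only [dirDeriv_of_isEmpty, sub_zero]
  have hZ := he.contDiffAt (k := 2) hU hx i
  set Z := e i
  have h12 : (1 : ℕ∞) ≤ 2 := by norm_num
  have e2 : (2 : ℕ∞) = 1 + 1 := by norm_num
  have hf1 := hf.mdifferentiableAt h12
  have hZ1 := hZ.fieldDiffAt h12
  have aux : ∀ A B : VField n M, FieldContDiffAt 2 A x → FieldContDiffAt 2 B x →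
      mlieBracket (𝓡 n) A (mlieBracket (𝓡 n) B (f • Z)) x =
        dirDeriv A (dirDeriv B f) x • Z x + dirDeriv B f x • mlieBracket (𝓡 n) A Z x
        + (dirDeriv A f x • mlieBracket (𝓡 n) B Z x
          + f x • mlieBracket (𝓡 n) A (mlieBracket (𝓡 n) B Z) x) := by
    intro A B hA hB
    have hBf := (he.dirDeriv_contDiffAt (k := 1) hU hx (e2 ▸ hB) (e2 ▸ hf)).mdifferentiableAt le_rfl
    have hBZ := (FieldContDiffAt.mlieBracket (k := 1) (e2 ▸ hB) (e2 ▸ hZ)).fieldDiffAt le_rfl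
    have hE : mlieBracket (𝓡 n) B (f • Z) =ᶠ[𝓝 x]
        (dirDeriv B f • Z + f • mlieBracket (𝓡 n) B Z : VField n M) :=
      mlieBracket_smul_section_eventually B hf hZ h12
    rw [Filter.EventuallyEq.mlieBracket_vectorField_eq (V := A) Filter.EventuallyEq.rfl hE,
      mlieBracket_add_right (hZ1.smul hBf) (hBZ.smul hf1), mlieBracket_smul_right hBf hZ1,
      mlieBracket_smul_right hf1 hBZ]
    rfl
  have m2 : ∀ A : VField n M, FieldContDiffAt 2 A x →
      ContMDiffAt (𝓡 n) ((𝓡 n).prod 𝓘(ℝ, EuclideanSpace ℝ (Fin n))) (minSmoothness ℝ 2)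
        (fun y => TotalSpace.mk' (EuclideanSpace ℝ (Fin n)) y (A y)) x := fun A hA => by
    rw [minSmoothness_of_isRCLikeNormedField]; exact hA
  have hman : IsManifold (𝓡 n) (minSmoothness ℝ 3) M :=
    by rw [minSmoothness_of_isRCLikeNormedField]; infer_instance
  have J := leibniz_identity_mlieBracket_apply (I := 𝓡 n) (m2 V hV) (m2 W hW) (m2 Z hZ)
  have J' := leibniz_identity_mlieBracket_apply (I := 𝓡 n) (m2 V hV) (m2 W hW)
    (m2 (f • Z) (FieldContDiffAt.smul hf hZ))
  rw [aux V W hV hW, aux W V hW hV, mlieBracket_smul_right hf1 hZ1, J] at J'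
  have hZn : (inner ℝ (Z x) (Z x) : ℝ) = 1 := by simpa using he.inner_eq hx i i
  have := congrArg (fun u => (inner ℝ (Z x) u : ℝ)) J'
  simp only [inner_add_right, real_inner_smul_right, hZn] at this
  linear_combination this

end Riemannian

/-! ### Connection forms and the first structure equation -/

section Connection

variable {n : ℕ} {M : Type*} [TopologicalSpace M] [ChartedSpace (EuclideanSpace ℝ (Fin n)) M]
  [IsManifold (𝓡 n) ∞ M]
  [RiemannianBundle (fun x : M => TangentSpace (𝓡 n) x)]
  [IsContMDiffRiemannianBundle (𝓡 n) ∞ (EuclideanSpace ℝ (Fin n))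
      (fun x : M => TangentSpace (𝓡 n) x)]
  {cov : CovariantDerivative (𝓡 n) (EuclideanSpace ℝ (Fin n)) (TangentSpace (𝓡 n) : M → Type _)}
  {e : Fin n → VField n M} {U : Set M} {k : ℕ∞} {x : M} {X Y Z V W : VField n M} {f : M → ℝ}

theorem IsLeviCivita.mvfderiv_inner (hcov : IsLeviCivita cov) (hY : FieldDiffAt Y x)
    (hZ : FieldDiffAt Z x) (v : TangentSpace (𝓡 n) x) :
    mvfderiv (𝓡 n) (fun y => inner ℝ (Y y) (Z y)) x v =
      inner ℝ (cov Y x v) (Z x) + inner ℝ (Y x) (cov Z x v) := by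
  have : IsContMDiffRiemannianBundle (𝓡 n) 1 (EuclideanSpace ℝ (Fin n))
      (TangentSpace (𝓡 n) : M → Type _) := isContMDiffRiemannianBundle_of_le 1
  obtain ⟨X, -, rfl⟩ := exists_fieldDiffAt v
  exact hcov.2.mvfderiv_inner_eq X hY hZ

theorem IsLeviCivita.sub_eq_mlieBracket (hcov : IsLeviCivita cov) (hX : FieldDiffAt X x)
    (hY : FieldDiffAt Y x) :
    cov Y x (X x) - cov X x (Y x) = mlieBracket (𝓡 n) X Y x :=
  (CovariantDerivative.torsion_eq_zero_iff cov).1 hcov.1 hX hY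

variable (hcov : IsLeviCivita cov) (he : IsOrthonormalFrameOn e U) (hU : IsOpen U) (hx : x ∈ U)
include hcov he hU hx

/-- The inner products `g(e_i, e_j)` are constant near `x`. -/
theorem connForm_skew (i j : Fin n) (v : TangentSpace (𝓡 n) x) :
    connForm cov e i j x v + connForm cov e j i x v = 0 := by
  have h := hcov.mvfderiv_inner (he.fieldDiffAt hU hx i) (he.fieldDiffAt hU hx j) v
  have hc : (fun y => inner ℝ (e i y) (e j y)) =ᶠ[𝓝 x] fun _ => if i = j then (1 : ℝ) else 0 := by
    filter_upwards [hU.mem_nhds hx] with y hy using he.inner_eq hy i j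
  rw [mvfderiv_congr hc, mvfderiv_const, real_inner_comm] at h
  change (inner ℝ (e i x) (cov (e j) x v) : ℝ) + inner ℝ (e j x) (cov (e i) x v) = 0
  rw [zero_apply] at h
  linarith

theorem inner_cov (hX : FieldDiffAt X x) (i : Fin n) (v : TangentSpace (𝓡 n) x) :
    inner ℝ (e i x) (cov X x v) =
      mvfderiv (𝓡 n) (comp e X i) x v + ∑ m, comp e X m x * connForm cov e i m x v := by
  have h := hcov.mvfderiv_inner (he.fieldDiffAt hU hx i) hX v
  have h2 : (inner ℝ (cov (e i) x v) (X x) : ℝ) =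
      -∑ m, comp e X m x * connForm cov e i m x v := by
    conv_lhs => rw [← he.sum_comp_smul hx X]
    rw [inner_sum, ← Finset.sum_neg_distrib]
    refine Finset.sum_congr rfl fun m _ => ?_
    have := connForm_skew hcov he hU hx i m v
    rw [real_inner_smul_right, real_inner_comm]
    change _ * connForm cov e m i x v = _
    rw [← mul_neg]
    congr 1
    linarith
  change mvfderiv (𝓡 n) (comp e X i) x v = _ at h
  rw [h, h2]
  ring

theorem jetComp_eq (hX : FieldDiffAt X x) (i k : Fin n) :
    jetComp e (connForm cov e) X i k x = inner ℝ (e i x) (cov X x (e k x)) :=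
  (inner_cov hcov he hU hx hX i (e k x)).symm

/-- A connection is not assumed to have any regularity. It is obtained here from the Koszul formula,
which in an orthonormal frame expresses ω^i_j(e_l) by the brackets of frame fields alone. -/
theorem connForm_frame_contDiffAt (i j l : Fin n) :
    FunContDiffAt (n := n) k (fun y => connForm cov e i j y (e l y)) x := by
  have hb : ∀ a b c : Fin n, FunContDiffAt (n := n) k
      (fun y => inner ℝ (e c y) (mlieBracket (𝓡 n) (e a) (e b) y)) x := fun a b c =>
    (he.contDiffAt hU hx c).inner
      ((he.contDiffAt hU hx a).mlieBracket (he.contDiffAt hU hx b))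
  refine ((FunContDiffAt.const (1 / 2)).mul (((hb l j i).sub (hb j i l)).add (hb i l j))).congr ?_
  filter_upwards [hU.mem_nhds hx] with y hy
  have ht : ∀ a b c : Fin n, (inner ℝ (e c y) (mlieBracket (𝓡 n) (e a) (e b) y) : ℝ) =
      connForm cov e c b y (e a y) - connForm cov e c a y (e b y) := fun a b c => by
    rw [← hcov.sub_eq_mlieBracket (he.fieldDiffAt hU hy a) (he.fieldDiffAt hU hy b),
      inner_sub_right]
    rfl
  rw [ht, ht, ht]
  have s1 := connForm_skew hcov he hU hy i j (e l y)
  have s2 := connForm_skew hcov he hU hy l i (e j y)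
  have s3 := connForm_skew hcov he hU hy l j (e i y)
  linear_combination (1 / 2) * s1 + (1 / 2) * s2 - (1 / 2) * s3

omit hcov [IsContMDiffRiemannianBundle (𝓡 n) ∞ (EuclideanSpace ℝ (Fin n))
    (fun x : M => TangentSpace (𝓡 n) x)] in
theorem connForm_eventually_eq (i j : Fin n) (V : VField n M) :
    (fun y => connForm cov e i j y (V y)) =ᶠ[𝓝 x]
      fun y => ∑ l, comp e V l y * connForm cov e i j y (e l y) := by
  filter_upwards [hU.mem_nhds hx] with y hy
  exact he.map_eq_sum hy (connForm cov e i j y).toLinearMap (V y)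

theorem connForm_contDiffAt (hV : FieldContDiffAt k V x) (i j : Fin n) :
    FunContDiffAt (n := n) k (fun y => connForm cov e i j y (V y)) x :=
  (FunContDiffAt.sum fun l _ => (he.comp_contDiffAt hU hx hV l).mul
    (connForm_frame_contDiffAt hcov he hU hx i j l)).congr
    (connForm_eventually_eq he hU hx i j V)

/-- Needed besides the `C^k` version because tensoriality is tested on fields that are merely
differentiable at the point. -/
theorem connForm_mdifferentiableAt (hV : FieldDiffAt V x) (i j : Fin n) :
    MDifferentiableAt (𝓡 n) 𝓘(ℝ, ℝ) (fun y => connForm cov e i j y (V y)) x :=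
  ((hasDeriv_finset_sum fun l _ => (he.comp_mdifferentiableAt hU hx hV l).mul
    ((connForm_frame_contDiffAt (k := 1) hcov he hU hx i j l).mdifferentiableAt le_rfl)).1
    ).congr_of_eventuallyEq (connForm_eventually_eq he hU hx i j V)

omit hcov in
-- Along the smooth frame fields no regularity is lost on the direction, so `V` itself need only be
-- `C^k`.
theorem dirDeriv_contDiffAt (hV : FieldContDiffAt k V x)
    (hf : FunContDiffAt (n := n) (k + 1) f x) : FunContDiffAt (n := n) k (dirDeriv V f) x := by
  refine (FunContDiffAt.sum (s := Finset.univ) fun l _ => (he.comp_contDiffAt hU hx hV l).mul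
    (he.dirDeriv_contDiffAt hU hx (he.contDiffAt hU hx l) hf)).congr ?_
  filter_upwards [hU.mem_nhds hx] with y hy
  exact he.map_eq_sum hy (mvfderiv (𝓡 n) f y).toLinearMap (V y)

theorem inner_cov_eventually (hX : FieldContDiffAt 1 X x) (V : VField n M) (i : Fin n) :
    comp e (fun y => cov X y (V y)) i =ᶠ[𝓝 x]
      fun y => dirDeriv V (comp e X i) y + ∑ m, comp e X m y * connForm cov e i m y (V y) := by
  filter_upwards [hU.mem_nhds hx, hX.eventually_fieldDiffAt le_rfl] with y hy hXy
  exact inner_cov hcov he hU hy hXy i (V y)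

theorem cov_contDiffAt (hX : FieldContDiffAt (k + 1) X x) (hV : FieldContDiffAt k V x) :
    FieldContDiffAt k (fun y => cov X y (V y)) x :=
  he.fieldContDiffAt hU hx fun i =>
    ((dirDeriv_contDiffAt he hU hx hV (he.comp_contDiffAt hU hx hX i)).add
      (FunContDiffAt.sum fun m _ => ((he.comp_contDiffAt hU hx hX m).of_le le_self_add).mul
        (connForm_contDiffAt hcov he hU hx hV i m))).congr
      (inner_cov_eventually hcov he hU hx (hX.of_le le_add_self) V i)

theorem jetComp_contDiffAt (hX : FieldContDiffAt (k + 1) X x) (i j : Fin n) :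
    FunContDiffAt (n := n) k (jetComp e (connForm cov e) X i j) x :=
  (dirDeriv_contDiffAt he hU hx (he.contDiffAt hU hx j) (he.comp_contDiffAt hU hx hX i)).add
    (FunContDiffAt.sum fun m _ => ((he.comp_contDiffAt hU hx hX m).of_le le_self_add).mul
      (connForm_frame_contDiffAt hcov he hU hx i m j))

/-- Replacing derivatives of components by covariant derivatives, the `∇` terms cancel against the
bracket by torsion-freeness; the connection terms that remain are the wedge sum. -/
theorem extD_coframe (hV : FieldDiffAt V x) (hW : FieldDiffAt W x) (i : Fin n) :
    extD (coframe e i) V W x =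
      ∑ k, wedge (coframe e k x) (connForm cov e i k x) (V x) (W x) := by
  have h1 : mvfderiv (𝓡 n) (fun y => coframe e i y (W y)) x (V x) =
    inner ℝ (e i x) (cov W x (V x)) - ∑ m, comp e W m x * connForm cov e i m x (V x) := by
    rw [inner_cov hcov he hU hx hW i]
    exact (add_sub_cancel_right _ _).symm
  have h2 : mvfderiv (𝓡 n) (fun y => coframe e i y (V y)) x (W x) =
    inner ℝ (e i x) (cov V x (W x)) - ∑ m, comp e V m x * connForm cov e i m x (W x) := by
    rw [inner_cov hcov he hU hx hV i]
    exact (add_sub_cancel_right _ _).symm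
  have h3 : coframe e i x (mlieBracket (𝓡 n) V W x) =
      inner ℝ (e i x) (cov W x (V x)) - inner ℝ (e i x) (cov V x (W x)) := by
    rw [← hcov.sub_eq_mlieBracket hV hW, ← inner_sub_right]
    rfl
  rw [extD, h1, h2, h3]
  simp only [wedge, Finset.sum_sub_distrib]
  change _ = ∑ m, comp e V m x * connForm cov e i m x (W x) -
    ∑ m, comp e W m x * connForm cov e i m x (V x)
  ring

end Connection

/-! ### Curvature in the frame and its symmetries -/

section Curvature

variable {n : ℕ} {M : Type*} [TopologicalSpace M] [ChartedSpace (EuclideanSpace ℝ (Fin n)) M]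
  [IsManifold (𝓡 n) ∞ M]
  [RiemannianBundle (fun x : M => TangentSpace (𝓡 n) x)]
  [IsContMDiffRiemannianBundle (𝓡 n) ∞ (EuclideanSpace ℝ (Fin n))
      (fun x : M => TangentSpace (𝓡 n) x)]
  {cov : CovariantDerivative (𝓡 n) (EuclideanSpace ℝ (Fin n)) (TangentSpace (𝓡 n) : M → Type _)}
  {e : Fin n → VField n M} {U : Set M} {k : ℕ∞} {x : M} {X Y Z V W : VField n M} {f : M → ℝ}
  (hcov : IsLeviCivita cov) (he : IsOrthonormalFrameOn e U) (hU : IsOpen U) (hx : x ∈ U)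
include hcov he hU hx

theorem inner_cov_cov (hZ : FieldContDiffAt 2 Z x) (hW : FieldContDiffAt 1 W x) (V : VField n M)
    (i : Fin n) :
    inner ℝ (e i x) (cov (fun y => cov Z y (W y)) x (V x)) =
      dirDeriv V (dirDeriv W (comp e Z i)) x +
      ∑ m, (comp e Z m x * dirDeriv V (fun y => connForm cov e i m y (W y)) x +
        connForm cov e i m x (W x) * dirDeriv V (comp e Z m) x) +
      ∑ m, (dirDeriv W (comp e Z m) x + ∑ p, comp e Z p x * connForm cov e m p x (W x)) *
        connForm cov e i m x (V x) := by
  have e2 : (2 : ℕ∞) = 1 + 1 := by norm_num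
  have hZ1 : FieldContDiffAt 1 Z x := hZ.of_le (by norm_num)
  have hev := inner_cov_eventually hcov he hU hx hZ1 W
  have hd : ∀ m, MDifferentiableAt (𝓡 n) 𝓘(ℝ, ℝ) (comp e Z m) x := fun m =>
    he.comp_mdifferentiableAt hU hx (hZ1.fieldDiffAt le_rfl) m
  have hΓ : ∀ m, MDifferentiableAt (𝓡 n) 𝓘(ℝ, ℝ) (fun y => connForm cov e i m y (W y)) x :=
    fun m => connForm_mdifferentiableAt hcov he hU hx (hW.fieldDiffAt le_rfl) i m
  have hdd : MDifferentiableAt (𝓡 n) 𝓘(ℝ, ℝ) (dirDeriv W (comp e Z i)) x :=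
    (dirDeriv_contDiffAt he hU hx hW
      (he.comp_contDiffAt hU hx (e2 ▸ hZ) i)).mdifferentiableAt le_rfl
  have hs := hasDeriv_finset_sum (s := Finset.univ)
    (f := fun m y => comp e Z m y * connForm cov e i m y (W y)) fun m _ => (hd m).mul (hΓ m)
  rw [inner_cov hcov he hU hx
    ((cov_contDiffAt hcov he hU hx (k := 1) (e2 ▸ hZ) hW).fieldDiffAt le_rfl) i (V x),
    mvfderiv_congr (hev i)]
  congr 1
  · rw [mvfderiv_fun_add hdd hs.1, add_apply, hs.2, sum_apply]
    congr 1
    refine Finset.sum_congr rfl fun m _ => ?_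
    rw [mvfderiv_fun_mul (hd m) (hΓ m)]
    rfl
  · refine Finset.sum_congr rfl fun m _ => ?_
    rw [(hev m).eq_of_nhds]

/-- Second derivatives of the components of `Z` antisymmetrize to a derivative along `[V, W]` and
cancel against `∇_{[V, W]} Z`. The terms with first derivatives of the components are symmetric in
`V` and `W`. What is left contains no derivative of `Z`. -/
theorem inner_curv (hV : FieldContDiffAt 2 V x) (hW : FieldContDiffAt 2 W x)
    (hZ : FieldContDiffAt 2 Z x) (i : Fin n) :
    inner ℝ (e i x) (curv cov V W Z x) =
      ∑ j, comp e Z j x * (extD (connForm cov e i j) V W x -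
        ∑ m, wedge (connForm cov e m j x) (connForm cov e i m x) (V x) (W x)) := by
  have h12 : (1 : ℕ∞) ≤ 2 := by norm_num
  have hb := he.dirDeriv_mlieBracket hU hx hV hW (he.comp_contDiffAt hU hx hZ i)
  rw [curv, inner_sub_right, inner_sub_right, inner_cov_cov hcov he hU hx hZ (hW.of_le h12) V i,
    inner_cov_cov hcov he hU hx hZ (hV.of_le h12) W i,
    inner_cov hcov he hU hx (hZ.fieldDiffAt h12) i, ← hb]
  -- Separates the terms with derivatives of the components from those quadratic in the connection
  -- forms.
  have hr : ∀ A B : VField n M, ∑ m, (dirDeriv A (comp e Z m) x +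
        ∑ p, comp e Z p x * connForm cov e m p x (A x)) * connForm cov e i m x (B x) =
      ∑ m, dirDeriv A (comp e Z m) x * connForm cov e i m x (B x) +
      ∑ p, comp e Z p x * ∑ m, connForm cov e m p x (A x) * connForm cov e i m x (B x) := by
    intro A B
    simp only [add_mul, Finset.sum_add_distrib, Finset.sum_mul, Finset.mul_sum]
    rw [Finset.sum_comm (f := fun m p => comp e Z p x * _ * _)]
    simp only [mul_assoc]
  rw [hr, hr]
  simp only [extD, wedge, mul_sub, Finset.sum_sub_distrib, Finset.sum_add_distrib]
  simp only [dirDeriv, mul_comm]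
  ring

theorem extD_connForm_tensorial_left (W : VField n M) (i j : Fin n) :
    TensorialAt (𝓡 n) (EuclideanSpace ℝ (Fin n)) (fun V => extD (connForm cov e i j) V W x) x where
  smul {f V} hf hV := by
    have h1 := connForm_mdifferentiableAt hcov he hU hx hV i j
    simp only [extD, Pi.smul_apply', map_smul, smul_eq_mul, mvfderiv_fun_mul hf h1,
      mlieBracket_smul_left hf hV, map_add, add_apply, smul_apply]
    ring
  add {V V'} hV hV' := by
    have h1 := connForm_mdifferentiableAt hcov he hU hx hV i j
    have h2 := connForm_mdifferentiableAt hcov he hU hx hV' i j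
    simp only [extD, Pi.add_apply, map_add, mvfderiv_fun_add h1 h2,
      mlieBracket_add_left hV hV', add_apply]
    ring

theorem extD_connForm_tensorial_right (V : VField n M) (i j : Fin n) :
    TensorialAt (𝓡 n) (EuclideanSpace ℝ (Fin n)) (fun W => extD (connForm cov e i j) V W x) x where
  smul {f W} hf hW := by
    have h1 := connForm_mdifferentiableAt hcov he hU hx hW i j
    simp only [extD, Pi.smul_apply', map_smul, smul_eq_mul, mvfderiv_fun_mul hf h1,
      mlieBracket_smul_right hf hW, map_add, add_apply, smul_apply]
    ring
  add {W W'} hW hW' := by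
    have h1 := connForm_mdifferentiableAt hcov he hU hx hW i j
    have h2 := connForm_mdifferentiableAt hcov he hU hx hW' i j
    simp only [extD, Pi.add_apply, map_add, mvfderiv_fun_add h1 h2,
      mlieBracket_add_right hW hW', add_apply]
    ring

theorem extD_connForm_eq_sum (hV : FieldDiffAt V x) (hW : FieldDiffAt W x) (i j : Fin n) :
    extD (connForm cov e i j) V W x =
      ∑ p, ∑ q, comp e V p x * comp e W q x * extD (connForm cov e i j) (e p) (e q) x := by
  let B := TensorialAt.mkHom₂ (F := EuclideanSpace ℝ (Fin n)) (F' := EuclideanSpace ℝ (Fin n))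
    (fun V W => extD (connForm cov e i j) V W x) x
    (fun W _ => extD_connForm_tensorial_left hcov he hU hx W i j)
    (fun V _ => extD_connForm_tensorial_right hcov he hU hx V i j)
  have hB : ∀ {V W : VField n M}, FieldDiffAt V x → FieldDiffAt W x →
      B (V x) (W x) = extD (connForm cov e i j) V W x := fun hV hW =>
    TensorialAt.mkHom₂_apply _ _ hV hW
  rw [← hB hV hW]
  have h1 := he.map_eq_sum hx B.toLinearMap (V x)
  change B (V x) = _ at h1
  rw [h1, sum_apply]
  refine Finset.sum_congr rfl fun p _ => ?_
  rw [smul_apply]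
  have h2 := he.map_eq_sum hx (B (e p x)).toLinearMap (W x)
  change B (e p x) (W x) = _ at h2
  change _ • B (e p x) (W x) = _
  rw [h2, smul_eq_mul, Finset.mul_sum]
  refine Finset.sum_congr rfl fun q _ => ?_
  rw [← hB (he.fieldDiffAt hU hx p) (he.fieldDiffAt hU hx q), mul_assoc]
  rfl

theorem curvCoeff_eq (i j p q : Fin n) :
    curvCoeff cov e i j p q x = extD (connForm cov e i j) (e p) (e q) x -
      ∑ m, wedge (connForm cov e m j x) (connForm cov e i m x) (e p x) (e q x) := by
  rw [curvCoeff, real_inner_comm, inner_curv hcov he hU hx (he.contDiffAt hU hx p)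
    (he.contDiffAt hU hx q) (he.contDiffAt hU hx j) i]
  simp [comp, he.inner_eq hx]

omit hcov hU [IsContMDiffRiemannianBundle (𝓡 n) ∞ (EuclideanSpace ℝ (Fin n))
      (fun x : M => TangentSpace (𝓡 n) x)] in
theorem wedge_eq_sum (α β : TangentSpace (𝓡 n) x →L[ℝ] ℝ) (v w : TangentSpace (𝓡 n) x) :
    wedge α β v w = ∑ p, ∑ q, (inner ℝ (e p x) v * inner ℝ (e q x) w : ℝ) *
      wedge α β (e p x) (e q x) := by
  have h : ∀ (γ : TangentSpace (𝓡 n) x →L[ℝ] ℝ) u, γ u = ∑ p, (inner ℝ (e p x) u : ℝ) * γ (e p x) :=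
    fun γ u => he.map_eq_sum hx γ.toLinearMap u
  rw [wedge, h α v, h β w, h α w, h β v, Finset.sum_mul_sum, Finset.sum_mul_sum, Finset.sum_comm
    (f := fun i j => inner ℝ (e i x) w * α (e i x) * (inner ℝ (e j x) v * β (e j x))),
    ← Finset.sum_sub_distrib]
  refine Finset.sum_congr rfl fun p _ => ?_
  rw [← Finset.sum_sub_distrib]
  refine Finset.sum_congr rfl fun q _ => ?_
  rw [wedge]
  ring

/-- Both sides are bilinear in the values of `V` and `W` at `x`, so frame pairs suffice, and there
it is `curvCoeff_eq`. -/
theorem extD_connForm_sub_wedge (hV : FieldDiffAt V x) (hW : FieldDiffAt W x) (i j : Fin n) :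
    extD (connForm cov e i j) V W x -
        ∑ m, wedge (connForm cov e m j x) (connForm cov e i m x) (V x) (W x) =
      ∑ p, ∑ q, comp e V p x * comp e W q x * curvCoeff cov e i j p q x := by
  rw [extD_connForm_eq_sum hcov he hU hx hV hW i j]
  simp only [curvCoeff_eq hcov he hU hx, mul_sub, Finset.sum_sub_distrib]
  congr 1
  simp only [Finset.mul_sum]
  rw [Finset.sum_congr rfl fun m _ => wedge_eq_sum he hx _ _ (V x) (W x), Finset.sum_comm]
  refine Finset.sum_congr rfl fun p _ => ?_
  rw [Finset.sum_comm]
  rfl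

theorem inner_curv_eq_sum (hV : FieldContDiffAt 2 V x) (hW : FieldContDiffAt 2 W x)
    (hZ : FieldContDiffAt 2 Z x) (i : Fin n) :
    inner ℝ (e i x) (curv cov V W Z x) =
      ∑ j, comp e Z j x * ∑ p, ∑ q, comp e V p x * comp e W q x * curvCoeff cov e i j p q x := by
  have h12 : (1 : ℕ∞) ≤ 2 := by norm_num
  rw [inner_curv hcov he hU hx hV hW hZ i]
  simp only [extD_connForm_sub_wedge hcov he hU hx (hV.fieldDiffAt h12) (hW.fieldDiffAt h12)]

omit hcov he hU hx [IsContMDiffRiemannianBundle (𝓡 n) ∞ (EuclideanSpace ℝ (Fin n))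
      (fun x : M => TangentSpace (𝓡 n) x)] in
theorem curvCoeff_swap (i j p q : Fin n) :
    curvCoeff cov e i j p q x + curvCoeff cov e i j q p x = 0 := by
  rw [curvCoeff, curvCoeff, ← inner_add_left, curv, curv,
    mlieBracket_swap_apply (V := e q) (W := e p), map_neg]
  convert inner_zero_left (𝕜 := ℝ) (e i x) using 2
  abel

/-- The double sum over all `k`, `l` counts each pair twice, since both the wedge and the curvature
coefficient change sign under exchange; hence the factor 1/2. -/
theorem extD_connForm (hV : FieldDiffAt V x) (hW : FieldDiffAt W x) (i j : Fin n) :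
    extD (connForm cov e i j) V W x =
      ∑ k, wedge (connForm cov e k j x) (connForm cov e i k x) (V x) (W x)
      + (1 / 2) * ∑ k, ∑ l, curvCoeff cov e i j k l x *
        wedge (coframe e k x) (coframe e l x) (V x) (W x) := by
  rw [← sub_eq_iff_eq_add', extD_connForm_sub_wedge hcov he hU hx hV hW i j]
  have h : ∑ k, ∑ l, curvCoeff cov e i j k l x * (comp e V l x * comp e W k x) =
      -∑ k, ∑ l, comp e V k x * comp e W l x * curvCoeff cov e i j k l x := by
    rw [Finset.sum_comm, ← Finset.sum_neg_distrib]
    refine Finset.sum_congr rfl fun p _ => ?_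
    rw [← Finset.sum_neg_distrib]
    refine Finset.sum_congr rfl fun q _ => ?_
    linear_combination comp e V p x * comp e W q x * curvCoeff_swap (cov := cov) (e := e) i j p q
  have h' : ∀ k l, wedge (coframe e k x) (coframe e l x) (V x) (W x) =
    comp e V k x * comp e W l x - comp e V l x * comp e W k x := fun k l => by
      rw [wedge, mul_comm (coframe e k x (W x))]; rfl
  simp only [h', mul_sub, Finset.sum_sub_distrib]
  rw [h]
  simp only [mul_comm]
  ring

/-- Skewness of the connection forms near `x` makes both dω^i_j and the quadratic term in
`curvCoeff_eq` skew in `i, j`. -/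
theorem curvCoeff_skew (i j p q : Fin n) :
    curvCoeff cov e i j p q x + curvCoeff cov e j i p q x = 0 := by
  have hd : ∀ l, mvfderiv (𝓡 n) (fun y => connForm cov e j i y (e l y)) x =
      -mvfderiv (𝓡 n) (fun y => connForm cov e i j y (e l y)) x := fun l => by
    rw [← mvfderiv_fun_neg]
    refine mvfderiv_congr ?_
    filter_upwards [hU.mem_nhds hx] with y hy
    linarith [connForm_skew hcov he hU hy i j (e l y)]
  have hs : ∀ a b v, connForm cov e a b x v = -connForm cov e b a x v := fun a b v => by
    linarith [connForm_skew hcov he hU hx a b v]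
  rw [curvCoeff_eq hcov he hU hx, curvCoeff_eq hcov he hU hx, extD, extD, hd, hd, hs j i]
  have hw : ∀ m, wedge (connForm cov e m i x) (connForm cov e j m x) (e p x) (e q x) =
      - wedge (connForm cov e m j x) (connForm cov e i m x) (e p x) (e q x) := fun m => by
    rw [wedge, wedge, hs m i, hs m i, hs j m, hs j m]
    ring
  simp only [hw, Finset.sum_neg_distrib, neg_apply]
  ring

theorem curvCoeff_contDiffAt (i j p q : Fin n) :
    FunContDiffAt (n := n) k (curvCoeff cov e i j p q) x := by
  have hE : ∀ {k} i, FieldContDiffAt k (e i) x := fun i => he.contDiffAt hU hx i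
  have h1 : ∀ a b, FieldContDiffAt k (fun y => cov (fun y => cov (e j) y (e b y)) y (e a y)) x :=
    fun a b => cov_contDiffAt hcov he hU hx (cov_contDiffAt hcov he hU hx (hE j) (hE b)) (hE a)
  have h2 : FieldContDiffAt k (fun y => cov (e j) y (mlieBracket (𝓡 n) (e p) (e q) y)) x :=
    cov_contDiffAt hcov he hU hx (hE j) ((hE p).mlieBracket (hE q))
  refine ((((h1 p q).inner (hE i)).sub ((h1 q p).inner (hE i))).sub (h2.inner (hE i))).congr
    (Filter.Eventually.of_forall fun y => ?_)
  simp only [curvCoeff, curv, inner_sub_left]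

theorem curvCoeff_bianchi (s i j k : Fin n) :
    curvCoeff cov e s i j k x + curvCoeff cov e s j k i x + curvCoeff cov e s k i j x = 0 := by
  have hE : ∀ {k} i, FieldContDiffAt k (e i) x := fun i => he.contDiffAt hU hx i
  have hN : ∀ a b, FieldDiffAt (fun y => cov (e a) y (e b y)) x := fun a b =>
    (cov_contDiffAt hcov he hU hx (k := 1) (hE a) (hE b)).fieldDiffAt le_rfl
  have hL : ∀ a b, FieldDiffAt (mlieBracket (𝓡 n) (e a) (e b)) x := fun a b =>
    (FieldContDiffAt.mlieBracket (k := 1) (hE a) (hE b)).fieldDiffAt le_rfl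
  -- Torsion-freeness, used for `[e_b, e_c]` near `x` and for its bracket with `e_a` at `x`,
  -- rewrites an iterated bracket by `∇`. Summed cyclically, the left sides regroup into the three
  -- curvatures, and the right sides cancel by Jacobi.
  have key : ∀ a b c, cov (fun y => cov (e c) y (e b y)) x (e a x) -
      cov (fun y => cov (e b) y (e c y)) x (e a x) -
      cov (e a) x (mlieBracket (𝓡 n) (e b) (e c) x) =
      mlieBracket (𝓡 n) (e a) (mlieBracket (𝓡 n) (e b) (e c)) x := fun a b c => by
    rw [← hcov.sub_eq_mlieBracket ((hE (k := 1) a).fieldDiffAt le_rfl) (hL b c)]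
    have hadd := cov.isCovariantDerivativeOn.add (s := univ) (hL b c) (hN b c) (mem_univ x)
    have heq : cov (mlieBracket (𝓡 n) (e b) (e c) + fun y => cov (e b) y (e c y)) x =
        cov (fun y => cov (e c) y (e b y)) x := by
      refine cov_congr cov (hN c b) ?_
      filter_upwards [hU.mem_nhds hx] with y hy
      change mlieBracket (𝓡 n) (e b) (e c) y + cov (e b) y (e c y) = cov (e c) y (e b y)
      rw [← hcov.sub_eq_mlieBracket (he.fieldDiffAt hU hy b) (he.fieldDiffAt hU hy c),
        sub_add_cancel]
    rw [← heq, hadd, add_apply]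
    abel
  have m2 : ∀ a, ContMDiffAt (𝓡 n) ((𝓡 n).prod 𝓘(ℝ, EuclideanSpace ℝ (Fin n)))
      (minSmoothness ℝ 2) (fun y => TotalSpace.mk' (EuclideanSpace ℝ (Fin n)) y (e a y)) x :=
    fun a => by rw [minSmoothness_of_isRCLikeNormedField]; exact hE (k := 2) a
  have hman : IsManifold (𝓡 n) (minSmoothness ℝ 3) M :=
    by rw [minSmoothness_of_isRCLikeNormedField]; infer_instance
  have J := leibniz_identity_mlieBracket_apply (I := 𝓡 n) (m2 i) (m2 j) (m2 k)
  rw [mlieBracket_swap_apply (V := mlieBracket (𝓡 n) (e i) (e j)), ← key, ← key, ← key,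
    mlieBracket_swap_apply (V := e i) (W := e k), map_neg] at J
  rw [curvCoeff, curvCoeff, curvCoeff, ← inner_add_left, ← inner_add_left]
  convert inner_zero_left (𝕜 := ℝ) (e s x) using 2
  rw [curv, curv, curv, ← sub_eq_zero.2 J]
  abel

end Curvature

/-! ### The structure equations and their uniqueness -/

section StructureEquations

variable {n : ℕ} {M : Type*} [TopologicalSpace M] [ChartedSpace (EuclideanSpace ℝ (Fin n)) M]
  [IsManifold (𝓡 n) ∞ M]
  [RiemannianBundle (fun x : M => TangentSpace (𝓡 n) x)]
  {e : Fin n → VField n M} {U : Set M}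

theorem structureEquationsOn
    [IsContMDiffRiemannianBundle (𝓡 n) ∞ (EuclideanSpace ℝ (Fin n))
      (fun x : M => TangentSpace (𝓡 n) x)]
    {cov : CovariantDerivative (𝓡 n) (EuclideanSpace ℝ (Fin n)) (TangentSpace (𝓡 n) : M → Type _)}
    (hcov : IsLeviCivita cov) (he : IsOrthonormalFrameOn e U) (hU : IsOpen U) :
    StructureEquationsOn e U (connForm cov e) (curvCoeff cov e) where
  smooth_form i j k x hx :=
    ContMDiffAt.contMDiffWithinAt (connForm_frame_contDiffAt (k := ⊤) hcov he hU hx i j k)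
  smooth_curv i j k l x hx :=
    ContMDiffAt.contMDiffWithinAt (curvCoeff_contDiffAt (k := ⊤) hcov he hU hx i j k l)
  skew x hx i j := by ext v; exact connForm_skew hcov he hU hx i j v
  first x hx V W hV hW i := extD_coframe hcov he hU hx hV.fieldDiffAt hW.fieldDiffAt i
  second x hx V W hV hW i j := extD_connForm hcov he hU hx hV.fieldDiffAt hW.fieldDiffAt i j
  curv_skew x _ i j k l := curvCoeff_swap i j k l
  bianchi x hx s i j k := curvCoeff_bianchi hcov he hU hx s i j k

theorem coframe_frame (he : IsOrthonormalFrameOn e U) {x : M} (hx : x ∈ U) (i j : Fin n) :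
    coframe e i x (e j x) = if i = j then 1 else 0 :=
  he.inner_eq hx i j

variable {Γ Γ' : Fin n → Fin n → Form n M} {R R' : Fin n → Fin n → Fin n → Fin n → M → ℝ}

/-- The first equation on frame pairs makes the difference of two solutions symmetric in the lower
index and the direction; it is skew in `i, j`, and an array with both properties vanishes. -/
theorem StructureEquationsOn.form_unique (he : IsOrthonormalFrameOn e U) (hU : IsOpen U)
    (h : StructureEquationsOn e U Γ R) (h' : StructureEquationsOn e U Γ' R') {x : M} (hx : x ∈ U)
    (i j : Fin n) : Γ' i j x = Γ i j x := by
  have hw : ∀ (Δ : Fin n → Fin n → Form n M) i p q,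
      ∑ k, wedge (coframe e k x) (Δ i k x) (e p x) (e q x) =
        Δ i p x (e q x) - Δ i q x (e p x) := fun Δ i p q => by
    simp [wedge, coframe_frame he hx, Finset.sum_sub_distrib]
  have hsmooth : ∀ p, FieldSmoothAt (e p) x := fun p => he.contDiffAt (k := ⊤) hU hx p
  have h1 : ∀ i p q, Γ' i p x (e q x) - Γ' i q x (e p x) =
      Γ i p x (e q x) - Γ i q x (e p x) := fun i p q => by
    rw [← hw, ← hw, ← h.first x hx _ _ (hsmooth p) (hsmooth q),
      ← h'.first x hx _ _ (hsmooth p) (hsmooth q)]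
  have h2 : ∀ i p q, Γ i p x (e q x) + Γ p i x (e q x) = 0 := fun i p q =>
    congrArg (fun L => L (e q x)) (h.skew x hx i p)
  have h2' : ∀ i p q, Γ' i p x (e q x) + Γ' p i x (e q x) = 0 := fun i p q =>
    congrArg (fun L => L (e q x)) (h'.skew x hx i p)
  have h3 : ∀ q, Γ' i j x (e q x) = Γ i j x (e q x) := fun q => by
    linarith [h1 i j q, h1 q i j, h1 j q i, h2 i j q, h2 j q i, h2 q i j, h2' i j q, h2' j q i,
      h2' q i j]
  ext v
  have e1 := he.map_eq_sum hx (Γ' i j x).toLinearMap v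
  have e2 := he.map_eq_sum hx (Γ i j x).toLinearMap v
  simp only [ContinuousLinearMap.coe_coe] at e1 e2
  rw [e1, e2]
  simp only [h3]

/-- The two families of forms agree on the open set `U`, hence so do their exterior derivatives, and
the second equation on a frame pair isolates the curvature coefficient. -/
theorem StructureEquationsOn.curv_unique (he : IsOrthonormalFrameOn e U) (hU : IsOpen U)
    (h : StructureEquationsOn e U Γ R) (h' : StructureEquationsOn e U Γ' R') {x : M} (hx : x ∈ U)
    (i j p q : Fin n) : R' i j p q x = R i j p q x := by
  have hΓ : ∀ {y}, y ∈ U → ∀ i j, Γ' i j y = Γ i j y := fun hy i j => h.form_unique he hU h' hy i j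
  have hsmooth : ∀ p, FieldSmoothAt (e p) x := fun p => he.contDiffAt (k := ⊤) hU hx p
  have hd : ∀ V W : VField n M, extD (Γ' i j) V W x = extD (Γ i j) V W x := fun V W => by
    have hc : ∀ V : VField n M, mvfderiv (𝓡 n) (fun y => Γ' i j y (V y)) x =
        mvfderiv (𝓡 n) (fun y => Γ i j y (V y)) x := fun V => mvfderiv_congr <| by
      filter_upwards [hU.mem_nhds hx] with y hy
      rw [hΓ hy]
    rw [extD, extD, hc, hc, hΓ hx]
  have hw : ∀ T : Fin n → Fin n → ℝ,
      ∑ k, ∑ l, T k l * wedge (coframe e k x) (coframe e l x) (e p x) (e q x) =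
        T p q - T q p := fun T => by
    simp [wedge, coframe_frame he hx, mul_sub, Finset.sum_sub_distrib]
  have s := h.second x hx _ _ (hsmooth p) (hsmooth q) i j
  have s' := h'.second x hx _ _ (hsmooth p) (hsmooth q) i j
  simp only [hΓ hx] at s'
  rw [hw (fun k l => R i j k l x)] at s
  rw [hd, s, hw (fun k l => R' i j k l x)] at s'
  linarith [h.curv_skew x hx i j p q, h'.curv_skew x hx i j p q]

end StructureEquations

/-! ### Coordinates on the 1-jet fibres -/

section Jets

variable {n : ℕ} {M : Type*} [TopologicalSpace M] [ChartedSpace (EuclideanSpace ℝ (Fin n)) M]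
  [IsManifold (𝓡 n) ∞ M]

/-- There is a smooth function with prescribed value and prescribed differential at a point. -/
theorem exists_fun_with_jet (x : M) (c : ℝ) (L : TangentSpace (𝓡 n) x →L[ℝ] ℝ) :
    ∃ f : M → ℝ, FunContDiffAt (n := n) ⊤ f x ∧ f x = c ∧ mvfderiv (𝓡 n) f x = L := by
  let φ := extChartAt (𝓡 n) x
  obtain ⟨A, hA⟩ := isInvertible_mfderiv_extChartAt (I := 𝓡 n) (mem_extChartAt_source (I := 𝓡 n) x)
  -- The desired function is affine in the chart; `L'` is `L` transported by the inverse `A.symm` of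
  -- the differential of the chart.
  let L' : EuclideanSpace ℝ (Fin n) →L[ℝ] ℝ := L ∘L
    (A.symm : TangentSpace (𝓡 n) (extChartAt (𝓡 n) x x) →L[ℝ] TangentSpace (𝓡 n) x)
  have hφ : ContMDiffAt (𝓡 n) 𝓘(ℝ, EuclideanSpace ℝ (Fin n)) ∞ φ x := contMDiffAt_extChartAt
  have hL' : ContMDiffAt 𝓘(ℝ, EuclideanSpace ℝ (Fin n)) 𝓘(ℝ, ℝ) ∞ L' (φ x) :=
    L'.contMDiff.contMDiffAt
  have hf : FunContDiffAt (n := n) ⊤ (fun y => L' (φ y)) x := ContMDiffAt.comp x hL' hφ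
  have hcst : FunContDiffAt (n := n) ⊤ (fun _ : M => c - L' (φ x)) x := FunContDiffAt.const _
  refine ⟨fun y => L' (φ y) + (c - L' (φ x)), hf.add hcst, by ring, ?_⟩
  rw [mvfderiv_fun_add (hf.mdifferentiableAt le_top) (hcst.mdifferentiableAt le_top),
    mvfderiv_const, add_zero]
  have h := mvfderiv_comp (I := 𝓡 n) (I' := 𝓘(ℝ, EuclideanSpace ℝ (Fin n))) (f := φ) (g := L') x
    L'.mdifferentiableAt (hφ.mdifferentiableAt (by simp))
  change mvfderiv (𝓡 n) (L' ∘ φ) x = L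
  rw [h, ← hA]
  ext v
  change mvfderiv 𝓘(ℝ, EuclideanSpace ℝ (Fin n)) L' (φ x) (A v) = L v
  have : mvfderiv 𝓘(ℝ, EuclideanSpace ℝ (Fin n)) L' (φ x) = L' := by
    ext w
    simp only [mvfderiv, mfderiv_eq_fderiv, ContinuousLinearMap.fderiv]
    rfl
  rw [this]
  exact congrArg L (A.symm_apply_apply v)

variable [RiemannianBundle (fun x : M => TangentSpace (𝓡 n) x)]
  {e : Fin n → VField n M} {U : Set M} {x : M} {X Y : VField n M}

theorem jetComp_congr_iff (he : IsOrthonormalFrameOn e U) (hx : x ∈ U)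
    (Γ : Fin n → Fin n → Form n M) (hcomp : ∀ i, comp e X i x = comp e Y i x) :
    (∀ i k, jetComp e Γ X i k x = jetComp e Γ Y i k x) ↔
      ∀ i, mvfderiv (𝓡 n) (comp e X i) x = mvfderiv (𝓡 n) (comp e Y i) x := by
  simp only [jetComp, hcomp, add_left_inj]
  refine forall_congr' fun i => ⟨fun h => ?_, fun h k => by rw [h]⟩
  ext v
  have e1 := he.map_eq_sum hx (mvfderiv (𝓡 n) (comp e X i) x).toLinearMap v
  have e2 := he.map_eq_sum hx (mvfderiv (𝓡 n) (comp e Y i) x).toLinearMap v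
  simp only [ContinuousLinearMap.coe_coe] at e1 e2
  rw [e1, e2]
  simp only [h]

theorem exists_field_with_jet (he : IsOrthonormalFrameOn e U) (hU : IsOpen U) (hx : x ∈ U)
    (Γ : Fin n → Fin n → Form n M) (ξ : Fin n → ℝ) (a : Fin n → Fin n → ℝ) :
    ∃ X : VField n M, FieldSmoothAt X x ∧ (∀ i, comp e X i x = ξ i) ∧
      ∀ i k, jetComp e Γ X i k x = a i k := by
  -- The prescribed differential is the relation defining ξ^i_k, solved for dξ^i.
  choose f hf hf0 hf1 using fun i => exists_fun_with_jet x (ξ i)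
    (∑ k, (a i k - ∑ m, ξ m * Γ i m x (e k x)) • coframe e k x)
  have hc : ∀ i, comp e (fun y => ∑ j, f j y • e j y) i =ᶠ[𝓝 x] f i := fun i => by
    filter_upwards [hU.mem_nhds hx] with y hy using he.comp_sum hy f i
  have hc0 : ∀ i, comp e (fun y => ∑ j, f j y • e j y) i x = ξ i := fun i => by
    rw [(hc i).eq_of_nhds, hf0]
  refine ⟨fun y => ∑ j, f j y • e j y,
    FieldContDiffAt.sum_smul (k := ⊤) hf fun i => he.contDiffAt hU hx i, hc0, fun i k => ?_⟩
  rw [jetComp, mvfderiv_congr (hc i), hf1]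
  simp [hc0, coframe_frame he hx]

variable [IsContMDiffRiemannianBundle (𝓡 n) ∞ (EuclideanSpace ℝ (Fin n))
    (fun x : M => TangentSpace (𝓡 n) x)]

/-- The coordinates of `v` in the trivialization of the tangent bundle around `x`. -/
def trivCoord (x y : M) (v : TangentSpace (𝓡 n) y) : EuclideanSpace ℝ (Fin n) :=
  (trivializationAt (EuclideanSpace ℝ (Fin n)) (TangentSpace (𝓡 n) : M → Type _) x ⟨y, v⟩).2

/-- The Leibniz rule for `X = ξ^i e_i` splits the derivative in the chart into a part given by the
differentials of the frame components and a part that sees only their values. -/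
theorem mvfderiv_trivCoord (he : IsOrthonormalFrameOn e U) (hU : IsOpen U) (hx : x ∈ U)
    (hX : FieldDiffAt X x) (v : TangentSpace (𝓡 n) x) :
    mvfderiv (𝓡 n) (fun y => trivCoord x y (X y)) x v =
      trivCoord x x (∑ i, mvfderiv (𝓡 n) (comp e X i) x v • e i x) +
        ∑ i, comp e X i x • mvfderiv (𝓡 n) (fun y => trivCoord x y (e i y)) x v := by
  let t := trivializationAt (EuclideanSpace ℝ (Fin n)) (TangentSpace (𝓡 n) : M → Type _) x
  have ht : ∀ y ∈ t.baseSet, ∀ v, trivCoord x y v = t.linearMapAt ℝ y v := fun y hy v => by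
    rw [t.coe_linearMapAt_of_mem hy]
    rfl
  have hsum : ∀ y ∈ t.baseSet, ∀ c : Fin n → ℝ,
      trivCoord x y (∑ i, c i • e i y) = ∑ i, c i • trivCoord x y (e i y) := fun y hy c => by
    simp only [ht y hy, map_sum, map_smul]
  have hxb : x ∈ t.baseSet := FiberBundle.mem_baseSet_trivializationAt' x
  have hev : (fun y => trivCoord x y (X y)) =ᶠ[𝓝 x]
      fun y => ∑ i, comp e X i y • trivCoord x y (e i y) := by
    filter_upwards [hU.mem_nhds hx, t.open_baseSet.mem_nhds hxb] with y hy hyb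
    rw [← hsum y hyb, he.sum_comp_smul hy]
  have hd : ∀ i, MDifferentiableAt (𝓡 n) 𝓘(ℝ, EuclideanSpace ℝ (Fin n))
      (fun y => trivCoord x y (e i y)) x := fun i =>
    (mdifferentiableAt_section _ _).1 (he.fieldDiffAt hU hx i)
  have hc := fun i => he.comp_mdifferentiableAt hU hx hX i
  rw [mvfderiv_congr hev, (hasDeriv_finset_sum (f := fun i y => comp e X i y • trivCoord x y (e i y))
    fun i _ => (hc i).smul (hd i)).2, sum_apply,
    hsum x hxb, ← Finset.sum_add_distrib]
  refine Finset.sum_congr rfl fun i _ => ?_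
  rw [mvfderiv_fun_smul (hc i) (hd i)]
  simp [add_comm]

/-- For fields with equal values the second parts of `mvfderiv_trivCoord` coincide, and the
trivialization is injective on the fibre, so the first parts can be compared componentwise. -/
theorem sameOneJet_iff (he : IsOrthonormalFrameOn e U) (hU : IsOpen U) (hx : x ∈ U)
    (hX : FieldDiffAt X x) (hY : FieldDiffAt Y x) :
    SameOneJet x X Y ↔ ∀ i, comp e X i x = comp e Y i x ∧
      mvfderiv (𝓡 n) (comp e X i) x = mvfderiv (𝓡 n) (comp e Y i) x := by
  have hval : X x = Y x ↔ ∀ i, comp e X i x = comp e Y i x :=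
    ⟨fun h i => by rw [comp, comp, h], fun h => he.ext hx h⟩
  have hinj : Function.Injective (trivCoord x x : TangentSpace (𝓡 n) x → _) := by
    let t := trivializationAt (EuclideanSpace ℝ (Fin n)) (TangentSpace (𝓡 n) : M → Type _) x
    exact (t.linearEquivAt ℝ x (FiberBundle.mem_baseSet_trivializationAt' x)).injective
  rw [SameOneJet, hval, forall_and]
  refine and_congr_right fun hcomp => ?_
  change mvfderiv (𝓡 n) (fun y => trivCoord x y (X y)) x =
    mvfderiv (𝓡 n) (fun y => trivCoord x y (Y y)) x ↔ _
  have h : ∀ v, mvfderiv (𝓡 n) (fun y => trivCoord x y (X y)) x v =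
      mvfderiv (𝓡 n) (fun y => trivCoord x y (Y y)) x v ↔
      ∀ i, mvfderiv (𝓡 n) (comp e X i) x v = mvfderiv (𝓡 n) (comp e Y i) x v := fun v => by
    rw [mvfderiv_trivCoord he hU hx hX, mvfderiv_trivCoord he hU hx hY]
    simp only [hcomp, add_left_inj, hinj.eq_iff]
    refine ⟨fun h i => ?_, fun h => by simp only [h]⟩
    have := congrArg (fun u => (inner ℝ (e i x) u : ℝ)) h
    simpa [inner_sum, real_inner_smul_right, he.inner_eq hx] using this
  simp only [ContinuousLinearMap.ext_iff, h]
  exact forall_comm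

theorem exists_oneJet_equiv (he : IsOrthonormalFrameOn e U) (hU : IsOpen U) (hx : x ∈ U)
    (Γ : Fin n → Fin n → Form n M) :
    ∃ φ : OneJet n x ≃ (Fin n → ℝ) × (Fin n → Fin n → ℝ),
      ∀ (X : VField n M) (hX : FieldSmoothAt X x),
        φ (oneJet x X hX) = (fun i => comp e X i x, fun i k => jetComp e Γ X i k x) := by
  let F : {X : VField n M // FieldSmoothAt X x} → (Fin n → ℝ) × (Fin n → Fin n → ℝ) :=
    fun X => (fun i => comp e X.1 i x, fun i k => jetComp e Γ X.1 i k x)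
  -- One direction makes the coordinate map well defined on jets, the other makes it injective.
  have hF : ∀ X Y : {X : VField n M // FieldSmoothAt X x}, SameOneJet x X.1 Y.1 ↔ F X = F Y := by
    intro X Y
    rw [sameOneJet_iff he hU hx X.2.fieldDiffAt Y.2.fieldDiffAt, Prod.ext_iff, funext_iff,
      funext_iff, forall_and]
    refine and_congr_right fun h => ?_
    rw [← jetComp_congr_iff he hx Γ h]
    simp only [F, funext_iff]
  let φ : OneJet n x → (Fin n → ℝ) × (Fin n → Fin n → ℝ) :=
    Quotient.lift F fun X Y h => (hF X Y).1 h
  refine ⟨Equiv.ofBijective φ ⟨?_, ?_⟩, fun X hX => rfl⟩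
  · rintro ⟨X⟩ ⟨Y⟩ h
    exact Quotient.sound ((hF X Y).2 h)
  · rintro ⟨ξ, a⟩
    obtain ⟨X, hX, h1, h2⟩ := exists_field_with_jet he hU hx Γ ξ a
    exact ⟨oneJet x X hX, Prod.ext (funext h1) (funext fun i => funext (h2 i))⟩

end Jets

/-! ### The Killing equation and the lifts to the jet bundle -/

section KillingEquation

variable {n : ℕ} {M : Type*} [TopologicalSpace M] [ChartedSpace (EuclideanSpace ℝ (Fin n)) M]
  [IsManifold (𝓡 n) ∞ M]
  [RiemannianBundle (fun x : M => TangentSpace (𝓡 n) x)]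
  [IsContMDiffRiemannianBundle (𝓡 n) ∞ (EuclideanSpace ℝ (Fin n))
      (fun x : M => TangentSpace (𝓡 n) x)]
  {cov : CovariantDerivative (𝓡 n) (EuclideanSpace ℝ (Fin n)) (TangentSpace (𝓡 n) : M → Type _)}
  {e : Fin n → VField n M} {U : Set M} {x : M} {X Y Z : VField n M}

theorem lieDerivMetric_eq (hcov : IsLeviCivita cov) (hX : FieldDiffAt X x) (hY : FieldDiffAt Y x)
    (hZ : FieldDiffAt Z x) :
    lieDerivMetric X Y Z x =
      inner ℝ (cov X x (Y x)) (Z x) + inner ℝ (Y x) (cov X x (Z x)) := by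
  rw [lieDerivMetric, hcov.mvfderiv_inner hY hZ, ← hcov.sub_eq_mlieBracket hX hY,
    ← hcov.sub_eq_mlieBracket hX hZ, inner_sub_left, inner_sub_right]
  ring

variable (hcov : IsLeviCivita cov) (he : IsOrthonormalFrameOn e U) (hU : IsOpen U) (hx : x ∈ U)
include hcov he hU hx

theorem cov_frame_eq_sum (hX : FieldDiffAt X x) (k : Fin n) :
    cov X x (e k x) = ∑ i, jetComp e (connForm cov e) X i k x • e i x := by
  simp only [jetComp_eq hcov he hU hx hX, he.sum_inner_smul hx]

/-- `L_X g` is the symmetrization of `∇X`, a bilinear form determined by its values on frame pairs.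
-/
theorem killingAt_iff (hX : FieldDiffAt X x) :
    KillingAt X x ↔ Skew (fun j k => jetComp e (connForm cov e) X j k x) := by
  simp only [Skew, jetComp_eq hcov he hU hx hX]
  constructor
  · intro h j k
    have := h (e j) (e k) (he.contDiffAt (k := ⊤) hU hx j) (he.contDiffAt (k := ⊤) hU hx k)
    rw [lieDerivMetric_eq hcov hX (he.fieldDiffAt hU hx j) (he.fieldDiffAt hU hx k),
      real_inner_comm] at this
    linarith
  · intro h Y Z hY hZ
    rw [lieDerivMetric_eq hcov hX hY.fieldDiffAt hZ.fieldDiffAt]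
    have h1 : ∀ v w, (inner ℝ (cov X x v) w : ℝ) = ∑ p, ∑ q, (inner ℝ (e p x) v *
        inner ℝ (e q x) w : ℝ) * inner ℝ (e q x) (cov X x (e p x)) := fun v w => by
      conv_lhs => rw [← he.sum_inner_smul hx v, ← he.sum_inner_smul hx w]
      simp only [map_sum, map_smul, sum_inner, inner_sum, real_inner_smul_left,
        real_inner_smul_right]
      rw [Finset.sum_comm]
      refine Finset.sum_congr rfl fun p _ => Finset.sum_congr rfl fun q _ => ?_
      rw [real_inner_comm (e q x) (cov X x (e p x))]
      ring
    rw [real_inner_comm _ (Y x), h1, h1, Finset.sum_comm, ← Finset.sum_add_distrib]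
    refine Finset.sum_eq_zero fun p _ => ?_
    rw [← Finset.sum_add_distrib]
    refine Finset.sum_eq_zero fun q _ => ?_
    linear_combination (inner ℝ (e q x) (Y x) * inner ℝ (e p x) (Z x) : ℝ) * h p q

theorem exists_unique_lift (ξ : Fin n → ℝ) (a : Fin n → Fin n → ℝ) (ha : Skew a)
    (v : TangentSpace (𝓡 n) x) : ∃ (η : Fin n → ℝ) (α : Fin n → Fin n → ℝ), Skew α ∧
      ∀ (η' : Fin n → ℝ) (α' : Fin n → Fin n → ℝ),
        ((∀ i, theta₁ e (connForm cov e) x ξ a i (v, η', α') = 0) ∧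
          ∀ i j, theta₂ e (connForm cov e) (curvCoeff cov e) x ξ a i j (v, η', α') = 0) ↔
        η' = η ∧ α' = α := by
  set Γ := connForm cov e
  set R := curvCoeff cov e
  -- The witnesses are the equations θ^i = 0 and θ^i_j = 0 solved for dξ^i and dξ^i_j.
  refine ⟨fun i => -∑ k, ξ k * Γ i k x v + ∑ k, a i k * coframe e k x v,
    fun i j => ∑ k, a i k * Γ k j x v - ∑ k, a k j * Γ i k x v
      - ∑ k, ∑ l, ξ k * R i j k l x * coframe e l x v, fun i j => ?_, fun η' α' => ?_⟩
  · have hΓ : ∀ i j, Γ i j x v = -Γ j i x v := fun i j =>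
      eq_neg_of_add_eq_zero_left (connForm_skew hcov he hU hx i j v)
    have hR : ∀ k l, R j i k l x = -R i j k l x := fun k l =>
      eq_neg_of_add_eq_zero_left (curvCoeff_skew hcov he hU hx j i k l)
    have ha' : ∀ i j, a i j = -a j i := fun i j => eq_neg_of_add_eq_zero_left (ha i j)
    have e1 : ∑ k, a k j * Γ i k x v = ∑ k, a j k * Γ k i x v :=
      Finset.sum_congr rfl fun k _ => by rw [ha' k j, hΓ i k]; ring
    have e2 : ∑ k, a k i * Γ j k x v = ∑ k, a i k * Γ k j x v :=
      Finset.sum_congr rfl fun k _ => by rw [ha' k i, hΓ j k]; ring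
    simp only [hR, e1, e2, mul_neg, neg_mul, Finset.sum_neg_distrib]
    ring
  · simp only [theta₁, theta₂, LinearMap.coe_mk, AddHom.coe_mk, funext_iff]
    refine and_congr (forall_congr' fun i => ?_) (forall_congr' fun i => forall_congr' fun j => ?_)
    · constructor <;> intro h <;> linarith
    · constructor <;> intro h <;> linarith

end KillingEquation

/-! ### Algebra of curvature symmetries -/

section Algebra

variable {n : ℕ}

/-- Algebraic curvature symmetries imply the symmetry under exchange of the index pairs. -/
theorem pair_symm {R : Fin n → Fin n → Fin n → Fin n → ℝ}
    (h1 : ∀ i j k l, R i j k l + R j i k l = 0) (h2 : ∀ i j k l, R i j k l + R i j l k = 0)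
    (hB : ∀ s i j k, R s i j k + R s j k i + R s k i j = 0) (i j k l : Fin n) :
    R i j k l = R k l i j := by
  -- Of the Bianchi identities with first index i, j, k, l, the first and fourth minus the second
  -- and third give twice the claim. The other facts identify equal terms up to sign.
  linarith [hB i j k l, hB j k l i, hB k l i j, hB l i j k, h1 i j k l, h1 k l i j, h1 j k l i,
    h1 l i j k, h1 i k l j, h1 j l i k, h2 i j k l, h2 k l i j, h2 j k l i, h2 l i j k,
    h2 i k l j, h2 j l i k, h1 k i l j, h1 l j i k, h2 k i l j, h2 l j i k, h1 i l j k,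
    h2 i l j k, h1 j k i l, h2 k j i l, h1 k j i l, h1 i k j l, h1 j l k i, h2 l j k i,
    h1 k i j l, h2 k i j l, h1 l i k j, h2 i l k j, h1 i l k j]

/-- A skew second covariant derivative that satisfies the Ricci identity is determined by the
curvature. -/
theorem eq_neg_of_skew_of_ricci {R : Fin n → Fin n → Fin n → Fin n → ℝ}
    (h1 : ∀ i j k l, R i j k l + R j i k l = 0) (h2 : ∀ i j k l, R i j k l + R i j l k = 0)
    (hB : ∀ s i j k, R s i j k + R s j k i + R s k i j = 0)
    {P : Fin n → Fin n → Fin n → ℝ} {ξ : Fin n → ℝ} (hP : ∀ i k l, P i k l + P k i l = 0)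
    (hR : ∀ i k l, P i k l - P i l k = ∑ m, ξ m * R i m l k) (i k l : Fin n) :
    P i k l + ∑ m, ξ m * R i k m l = 0 := by
  -- Pair symmetry brings the first two terms to the form of the Bianchi identity with first index
  -- `i`, which leaves twice one curvature term.
  have hsum : ∑ m, ξ m * R k m i l - ∑ m, ξ m * R l m k i + ∑ m, ξ m * R i m l k +
      2 * ∑ m, ξ m * R i k m l = 0 := by
    rw [Finset.mul_sum, ← Finset.sum_sub_distrib, ← Finset.sum_add_distrib,
      ← Finset.sum_add_distrib]
    refine Finset.sum_eq_zero fun m _ => ?_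
    have e1 := pair_symm h1 h2 hB k m i l
    have e2 := pair_symm h1 h2 hB l m k i
    have e5 := h1 k i l m
    have e6 := hB i k m l
    have : R k m i l - R l m k i + R i m l k + 2 * R i k m l = 0 := by
      linarith [h1 i k l m, h2 i k l m, h2 i l k m, h2 i m l k, h2 i l m k]
    linear_combination ξ m * this
  -- As in the Koszul formula: by skewness, the Ricci identities for `(i, k, l)` and `(k, l, i)`
  -- minus the one for `(l, i, k)` add up to `2 * P i k l`.
  linarith [hP i k l, hP i l k, hP k l i, hP k i l, hP l i k, hP l k i, hR i k l, hR l i k,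
    hR k l i]

end Algebra

/-! ### The Pfaffian system on 1-jets and the identity of Kostant -/

section Prolongation

variable {n : ℕ} {M : Type*} [TopologicalSpace M] [ChartedSpace (EuclideanSpace ℝ (Fin n)) M]
  [IsManifold (𝓡 n) ∞ M]
  [RiemannianBundle (fun x : M => TangentSpace (𝓡 n) x)]
  {e : Fin n → VField n M} {U : Set M} {x : M} {X Y Z : VField n M}

/-- The derivative of a section of `J¹(TM)` as a linear map. -/
def sectionDerivLinear (ξ : Fin n → M → ℝ) (a : Fin n → Fin n → M → ℝ) (x : M) :
    TangentSpace (𝓡 n) x →ₗ[ℝ] JetTangent n x where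
  toFun := sectionDeriv ξ a x
  map_add' v w := by
    simp only [sectionDeriv, map_add]
    rfl
  map_smul' c v := by
    simp only [sectionDeriv, map_smul]
    rfl

/-- The pullback of `θ^i_j` under the 1-jet of `X`. -/
def pullbackTheta₂ (e : Fin n → VField n M) (Γ : Fin n → Fin n → Form n M)
    (R : Fin n → Fin n → Fin n → Fin n → M → ℝ) (X : VField n M) (x : M) (i j : Fin n) :
    TangentSpace (𝓡 n) x →ₗ[ℝ] ℝ :=
  theta₂ e Γ R x (fun k => comp e X k x) (fun k l => jetComp e Γ X k l x) i j ∘ₗ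
    sectionDerivLinear (comp e X) (jetComp e Γ X) x

/-- This is the relation defining ξ^i_k, extended linearly from the frame. The functions `a'` are
arbitrary because θ^i contains no dξ^i_j. -/
theorem theta₁_jet (he : IsOrthonormalFrameOn e U) (hx : x ∈ U) (Γ : Fin n → Fin n → Form n M)
    (X : VField n M) (a' : Fin n → Fin n → M → ℝ) (v : TangentSpace (𝓡 n) x) (i : Fin n) :
    theta₁ e Γ x (fun k => comp e X k x) (fun k l => jetComp e Γ X k l x) i
      (sectionDeriv (comp e X) a' x v) = 0 := by
  let L : TangentSpace (𝓡 n) x →L[ℝ] ℝ :=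
    mvfderiv (𝓡 n) (comp e X i) x + ∑ m, comp e X m x • Γ i m x
  have hL : ∀ w, L w = mvfderiv (𝓡 n) (comp e X i) x w + ∑ m, comp e X m x * Γ i m x w :=
    fun w => by simp [L]
  have h := he.map_eq_sum hx L.toLinearMap v
  simp only [ContinuousLinearMap.coe_coe, smul_eq_mul] at h
  change mvfderiv (𝓡 n) (comp e X i) x v + ∑ k, comp e X k x * Γ i k x v -
    ∑ k, jetComp e Γ X i k x * coframe e k x v = 0
  rw [← hL, h, sub_eq_zero]
  refine Finset.sum_congr rfl fun k _ => ?_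
  rw [hL, mul_comm]
  rfl

theorem pfaffAt_iff (he : IsOrthonormalFrameOn e U) (hx : x ∈ U) (Γ : Fin n → Fin n → Form n M)
    (R : Fin n → Fin n → Fin n → Fin n → M → ℝ) (X : VField n M) :
    PfaffAt e Γ R (comp e X) (jetComp e Γ X) x ↔
      ∀ i k l, pullbackTheta₂ e Γ R X x i k (e l x) = 0 := by
  refine ⟨fun h i k l => (h (e l x)).2 i k, fun h v =>
    ⟨theta₁_jet he hx Γ X _ v, fun i j => ?_⟩⟩
  change pullbackTheta₂ e Γ R X x i j v = 0
  rw [he.map_eq_sum hx (pullbackTheta₂ e Γ R X x i j) v]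
  simp [h]

variable [IsContMDiffRiemannianBundle (𝓡 n) ∞ (EuclideanSpace ℝ (Fin n))
    (fun x : M => TangentSpace (𝓡 n) x)]
  {cov : CovariantDerivative (𝓡 n) (EuclideanSpace ℝ (Fin n)) (TangentSpace (𝓡 n) : M → Type _)}

/-- The Ricci identity: by torsion-freeness the two correction terms combine to `∇_{[Y, Z]} X`. -/
theorem covDerivNabla_sub_covDerivNabla (hcov : IsLeviCivita cov) (hY : FieldDiffAt Y x) (hZ : FieldDiffAt Z x)
    (X : VField n M) :
    covDerivNabla cov Y X Z x - covDerivNabla cov Z X Y x = curv cov Y Z X x := by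
  rw [covDerivNabla, covDerivNabla, curv, ← hcov.sub_eq_mlieBracket hY hZ, map_sub]
  abel

variable (hcov : IsLeviCivita cov) (he : IsOrthonormalFrameOn e U) (hU : IsOpen U) (hx : x ∈ U)
include hcov he hU hx

/-- The derivatives of the components of `Z` in `∇_Y (∇_Z X)` cancel against those in `∇_{∇_Y Z} X`.
-/
theorem inner_covDerivNabla (hX : FieldContDiffAt 2 X x) (hZ : FieldContDiffAt 1 Z x)
    (Y : VField n M) (i : Fin n) :
    inner ℝ (e i x) (covDerivNabla cov Y X Z x) = ∑ k, comp e Z k x *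
      (mvfderiv (𝓡 n) (jetComp e (connForm cov e) X i k) x (Y x) +
        ∑ m, jetComp e (connForm cov e) X m k x * connForm cov e i m x (Y x) -
        ∑ m, jetComp e (connForm cov e) X i m x * connForm cov e m k x (Y x)) := by
  set A := jetComp e (connForm cov e) X
  have e2 : (2 : ℕ∞) = 1 + 1 := by norm_num
  have hXd := hX.fieldDiffAt (by norm_num)
  have hA : ∀ i k, MDifferentiableAt (𝓡 n) 𝓘(ℝ, ℝ) (A i k) x := fun i k =>
    (jetComp_contDiffAt hcov he hU hx (k := 1) (e2 ▸ hX) i k).mdifferentiableAt le_rfl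
  have hZc : ∀ k, MDifferentiableAt (𝓡 n) 𝓘(ℝ, ℝ) (comp e Z k) x := fun k =>
    he.comp_mdifferentiableAt hU hx (hZ.fieldDiffAt le_rfl) k
  have hc : ∀ {y}, y ∈ U → FieldDiffAt X y → ∀ w i, (inner ℝ (e i y) (cov X y w) : ℝ) =
      ∑ k, A i k y * inner ℝ (e k y) w := fun {y} hy hXy w i => by
    have := he.map_eq_sum hy (cov X y).toLinearMap w
    simp only [ContinuousLinearMap.coe_coe] at this
    rw [this, inner_sum]
    refine Finset.sum_congr rfl fun k _ => ?_
    rw [real_inner_smul_right, ← jetComp_eq hcov he hU hy hXy, mul_comm]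
  have hev : ∀ i, comp e (fun y => cov X y (Z y)) i =ᶠ[𝓝 x]
      fun y => ∑ k, A i k y * comp e Z k y := fun i => by
    filter_upwards [hU.mem_nhds hx, hX.eventually_fieldDiffAt (by norm_num)] with y hy hXy
    exact hc hy hXy (Z y) i
  rw [covDerivNabla, inner_sub_right, inner_cov hcov he hU hx
    ((cov_contDiffAt hcov he hU hx (k := 1) (e2 ▸ hX) hZ).fieldDiffAt le_rfl) i (Y x),
    hc hx hXd, mvfderiv_congr (hev i), (hasDeriv_finset_sum
      (f := fun k y => A i k y * comp e Z k y) fun k _ => (hA i k).mul (hZc k)).2, sum_apply]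
  simp only [fun m => (hev m).eq_of_nhds,
    fun k => inner_cov hcov he hU hx (hZ.fieldDiffAt le_rfl) k (Y x),
    fun k => mvfderiv_fun_mul (hA i k) (hZc k), add_apply, smul_apply, smul_eq_mul, mul_add,
    mul_sub, Finset.sum_add_distrib, Finset.sum_sub_distrib, Finset.sum_mul, Finset.mul_sum]
  rw [Finset.sum_comm (f := fun m k => A m k x * comp e Z k x * connForm cov e i m x (Y x)),
    Finset.sum_comm (f := fun k m => A i k x * (comp e Z m x * connForm cov e k m x (Y x)))]
  simp only [mul_comm, mul_left_comm]
  ring_nf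

/-- The bridge between the Pfaffian system and its invariant form, for any `C²` field, Killing or
not. -/
theorem inner_covDerivNabla_sub_curv (hX : FieldContDiffAt 2 X x) (hY : FieldContDiffAt 2 Y x)
    (hZ : FieldContDiffAt 2 Z x) (i : Fin n) :
    inner ℝ (e i x) (covDerivNabla cov Y X Z x - curv cov Y X Z x) = ∑ k, comp e Z k x *
      pullbackTheta₂ e (connForm cov e) (curvCoeff cov e) X x i k (Y x) := by
  rw [inner_sub_right, inner_covDerivNabla hcov he hU hx hX (hZ.of_le (by norm_num)) Y i,
    inner_curv_eq_sum hcov he hU hx hY hX hZ i, ← Finset.sum_sub_distrib]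
  refine Finset.sum_congr rfl fun k _ => ?_
  rw [← mul_sub]
  congr 1
  have h : ∑ p, ∑ q, comp e Y p x * comp e X q x * curvCoeff cov e i k p q x =
      -∑ m, ∑ l, comp e X m x * curvCoeff cov e i k m l x * coframe e l x (Y x) := by
    rw [Finset.sum_comm, ← Finset.sum_neg_distrib]
    refine Finset.sum_congr rfl fun q _ => ?_
    rw [← Finset.sum_neg_distrib]
    refine Finset.sum_congr rfl fun p _ => ?_
    change comp e Y p x * comp e X q x * _ = -(comp e X q x * _ * comp e Y p x)
    linear_combination comp e Y p x * comp e X q x *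
      curvCoeff_swap (cov := cov) (e := e) (x := x) i k p q
  rw [h]
  change _ = mvfderiv (𝓡 n) (jetComp e (connForm cov e) X i k) x (Y x)
    - ∑ m, jetComp e (connForm cov e) X i m x * connForm cov e m k x (Y x)
    + ∑ m, jetComp e (connForm cov e) X m k x * connForm cov e i m x (Y x)
    + ∑ m, ∑ l, comp e X m x * curvCoeff cov e i k m l x * coframe e l x (Y x)
  ring

theorem covDerivNabla_eq_curv_iff (hX : FieldContDiffAt 2 X x) :
    (∀ Y Z : VField n M, FieldSmoothAt Y x → FieldSmoothAt Z x →
      covDerivNabla cov Y X Z x = curv cov Y X Z x) ↔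
    PfaffAt e (connForm cov e) (curvCoeff cov e) (comp e X) (jetComp e (connForm cov e) X) x := by
  constructor
  · intro h
    rw [pfaffAt_iff he hx]
    intro i k l
    have := inner_covDerivNabla_sub_curv hcov he hU hx hX (he.contDiffAt hU hx l)
      (he.contDiffAt hU hx k) i
    rw [h _ _ (he.contDiffAt (k := ⊤) hU hx l) (he.contDiffAt (k := ⊤) hU hx k), sub_self,
      inner_zero_right] at this
    simpa [comp, he.inner_eq hx] using this.symm
  · intro h Y Z hY hZ
    refine sub_eq_zero.1 (he.ext hx fun i => ?_)
    rw [inner_covDerivNabla_sub_curv hcov he hU hx hX (hY.fieldContDiffAt.of_le le_top)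
      (hZ.fieldContDiffAt.of_le le_top) i, inner_zero_right]
    exact Finset.sum_eq_zero fun k _ => mul_eq_zero_of_right _ ((h (Y x)).2 i k)

/-- The Killing equation is needed on a neighbourhood because the skewness of ξ^i_k is
differentiated. The second covariant derivative then satisfies the hypotheses of
`eq_neg_of_skew_of_ricci`. -/
theorem pfaffAt_of_killing (hX : FieldContDiffAt 2 X x) (hK : ∀ᶠ y in 𝓝 x, KillingAt X y) :
    PfaffAt e (connForm cov e) (curvCoeff cov e) (comp e X) (jetComp e (connForm cov e) X) x := by
  set Γ := connForm cov e
  have hΓ : ∀ a b v, Γ a b x v = -Γ b a x v := fun a b v =>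
    eq_neg_of_add_eq_zero_left (connForm_skew hcov he hU hx a b v)
  have hAev : ∀ᶠ y in 𝓝 x, ∀ i k, jetComp e Γ X k i y = -jetComp e Γ X i k y := by
    filter_upwards [hU.mem_nhds hx, hX.eventually_fieldDiffAt (by norm_num), hK] with y hy hXy hKy
    exact fun i k => eq_neg_of_add_eq_zero_left ((killingAt_iff hcov he hU hy hXy).1 hKy k i)
  have hA := hAev.self_of_nhds
  have hdA : ∀ i k v, mvfderiv (𝓡 n) (jetComp e Γ X k i) x v =
      -mvfderiv (𝓡 n) (jetComp e Γ X i k) x v := fun i k v => by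
    have : jetComp e Γ X k i =ᶠ[𝓝 x] fun y => -jetComp e Γ X i k y := hAev.mono fun y hy => hy i k
    rw [mvfderiv_congr this, mvfderiv_fun_neg]
    rfl
  have hE : ∀ {k} i, FieldContDiffAt k (e i) x := fun i => he.contDiffAt hU hx i
  let P : Fin n → Fin n → Fin n → ℝ := fun i k l =>
    inner ℝ (e i x) (covDerivNabla cov (e l) X (e k) x)
  have hPeq : ∀ i k l, P i k l = mvfderiv (𝓡 n) (jetComp e Γ X i k) x (e l x) +
      ∑ m, jetComp e Γ X m k x * Γ i m x (e l x) -
      ∑ m, jetComp e Γ X i m x * Γ m k x (e l x) := fun i k l => by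
    simp only [P]
    rw [inner_covDerivNabla hcov he hU hx hX (hE k) (e l) i]
    simp [comp, he.inner_eq hx, Γ]
  have hPskew : ∀ i k l, P i k l + P k i l = 0 := fun i k l => by
    rw [hPeq, hPeq, hdA i k]
    have e1 : ∑ m, jetComp e Γ X m i x * Γ k m x (e l x) =
        ∑ m, jetComp e Γ X i m x * Γ m k x (e l x) :=
      Finset.sum_congr rfl fun m _ => by rw [hA i m, hΓ k m]; ring
    have e2 : ∑ m, jetComp e Γ X k m x * Γ m i x (e l x) =
        ∑ m, jetComp e Γ X m k x * Γ i m x (e l x) :=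
      Finset.sum_congr rfl fun m _ => by rw [hA m k, hΓ m i]; ring
    rw [e1, e2]
    ring
  have hRicci : ∀ i k l, P i k l - P i l k =
      ∑ m, comp e X m x * curvCoeff cov e i m l k x := fun i k l => by
    simp only [P]
    rw [← inner_sub_right, covDerivNabla_sub_covDerivNabla hcov
      (he.fieldDiffAt hU hx l) (he.fieldDiffAt hU hx k),
      inner_curv_eq_sum hcov he hU hx (hE l) (hE k) hX i]
    simp [comp, he.inner_eq hx]
  rw [pfaffAt_iff he hx]
  intro i k l
  have := eq_neg_of_skew_of_ricci (R := fun i j k l => curvCoeff cov e i j k l x)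
    (curvCoeff_skew hcov he hU hx) (curvCoeff_swap (cov := cov) (e := e) (x := x))
    (curvCoeff_bianchi hcov he hU hx) hPskew hRicci i k l
  rw [hPeq] at this
  change mvfderiv (𝓡 n) (jetComp e Γ X i k) x (e l x)
    - ∑ m, jetComp e Γ X i m x * Γ m k x (e l x)
    + ∑ m, jetComp e Γ X m k x * Γ i m x (e l x)
    + ∑ m, ∑ p, comp e X m x * curvCoeff cov e i k m p x * coframe e p x (e l x) = 0
  simp only [coframe_frame he hx, mul_ite, mul_one, mul_zero, Finset.sum_ite_eq',
    Finset.mem_univ, if_true]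
  linarith

end Prolongation

/-! ### Integral sections and second derivatives of Killing fields -/

section IntegralSections

variable {n : ℕ} {M : Type*} [TopologicalSpace M] [ChartedSpace (EuclideanSpace ℝ (Fin n)) M]
  [IsManifold (𝓡 n) ∞ M]
  {e : Fin n → VField n M} {U W : Set M} {x : M} {X : VField n M} {k : ℕ∞}

theorem FieldContDiffOn.fieldContDiffAt (hX : FieldContDiffOn k X W) (hW : IsOpen W) (hx : x ∈ W) :
    FieldContDiffAt k X x :=
  ContMDiffOn.contMDiffAt hX (hW.mem_nhds hx)

variable [RiemannianBundle (fun x : M => TangentSpace (𝓡 n) x)]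

omit [IsManifold (𝓡 n) ∞ M] in
theorem PfaffAt.congr {Γ : Fin n → Fin n → Form n M} {R : Fin n → Fin n → Fin n → Fin n → M → ℝ}
    {ξ ξ' : Fin n → M → ℝ} {a a' : Fin n → Fin n → M → ℝ} (h : PfaffAt e Γ R ξ a x)
    (hξ : ∀ i, ξ' i =ᶠ[𝓝 x] ξ i) (ha : ∀ i j, a' i j =ᶠ[𝓝 x] a i j) :
    PfaffAt e Γ R ξ' a' x := by
  intro v
  have hs : sectionDeriv ξ' a' x v = sectionDeriv ξ a x v := by
    refine Prod.ext rfl (Prod.ext (funext fun i => ?_) (funext fun i => funext fun j => ?_))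
    · change mvfderiv (𝓡 n) (ξ' i) x v = mvfderiv (𝓡 n) (ξ i) x v
      rw [mvfderiv_congr (hξ i)]
    · change mvfderiv (𝓡 n) (a' i j) x v = mvfderiv (𝓡 n) (a i j) x v
      rw [mvfderiv_congr (ha i j)]
  simp only [hs, fun i => (hξ i).eq_of_nhds, fun i j => (ha i j).eq_of_nhds]
  exact h v

variable [IsContMDiffRiemannianBundle (𝓡 n) ∞ (EuclideanSpace ℝ (Fin n))
    (fun x : M => TangentSpace (𝓡 n) x)]
  {cov : CovariantDerivative (𝓡 n) (EuclideanSpace ℝ (Fin n)) (TangentSpace (𝓡 n) : M → Type _)}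

theorem integral_section_iff (hcov : IsLeviCivita cov) (he : IsOrthonormalFrameOn e U)
    (hU : IsOpen U) (hWU : W ⊆ U) (hW : IsOpen W) (ξ : Fin n → M → ℝ) (a : Fin n → Fin n → M → ℝ) :
    ((∀ i, FunSmoothOn (n := n) (ξ i) W) ∧ (∀ i j, FunSmoothOn (n := n) (a i j) W) ∧
      ∀ x ∈ W, Skew (fun j k => a j k x) ∧
        PfaffAt e (connForm cov e) (curvCoeff cov e) ξ a x) ↔
    (FieldContDiffOn ⊤ (fun x => ∑ i, ξ i x • e i x) W ∧
      ∀ x ∈ W, KillingAt (fun x => ∑ i, ξ i x • e i x) x ∧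
        ∀ i k, a i k x = jetComp e (connForm cov e) (fun x => ∑ i, ξ i x • e i x) i k x) := by
  set X : VField n M := fun x => ∑ i, ξ i x • e i x
  have hc : ∀ x ∈ W, ∀ i, comp e X i =ᶠ[𝓝 x] ξ i := fun x hx i => by
    filter_upwards [hU.mem_nhds (hWU hx)] with y hy using he.comp_sum hy ξ i
  constructor
  · rintro ⟨hξ, -, h⟩
    have hX : ∀ x ∈ W, FieldContDiffAt ⊤ X x := fun x hx =>
      FieldContDiffAt.sum_smul (fun i => (hξ i).contMDiffAt (hW.mem_nhds hx))
        fun i => he.contDiffAt hU (hWU hx) i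
    have ha : ∀ x ∈ W, ∀ i k, a i k x = jetComp e (connForm cov e) X i k x := by
      intro x hx i k
      -- Evaluated on `e k`, the equation θ^i = 0 says that `a i k` is the jet coordinate of `X`.
      have h1 := ((h x hx).2 (e k x)).1 i
      change mvfderiv (𝓡 n) (ξ i) x (e k x) + ∑ m, ξ m x * connForm cov e i m x (e k x) -
        ∑ m, a i m x * coframe e m x (e k x) = 0 at h1
      rw [jetComp, mvfderiv_congr (hc x hx i)]
      simp only [fun m => (hc x hx m).eq_of_nhds]
      simp only [coframe_frame he (hWU hx), mul_ite, mul_one, mul_zero, Finset.sum_ite_eq',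
        Finset.mem_univ, if_true] at h1
      linarith
    refine ⟨fun x hx => ContMDiffAt.contMDiffWithinAt (hX x hx), fun x hx => ⟨?_, ha x hx⟩⟩
    rw [killingAt_iff hcov he hU (hWU hx) ((hX x hx).fieldDiffAt le_top)]
    simpa only [ha x hx] using (h x hx).1
  · rintro ⟨hX, h⟩
    have hXx : ∀ x ∈ W, FieldContDiffAt ⊤ X x := fun x hx => hX.fieldContDiffAt hW hx
    have ha : ∀ x ∈ W, ∀ i k, a i k =ᶠ[𝓝 x] jetComp e (connForm cov e) X i k :=
      fun x hx i k => by
        filter_upwards [hW.mem_nhds hx] with y hy using (h y hy).2 i k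
    refine ⟨fun i x hx => ContMDiffAt.contMDiffWithinAt ((he.comp_contDiffAt hU (hWU hx)
        (hXx x hx) i).congr (hc x hx i).symm),
      fun i j x hx => ContMDiffAt.contMDiffWithinAt ((jetComp_contDiffAt (k := ⊤) hcov he hU
        (hWU hx) (hXx x hx) i j).congr (ha x hx i j)), fun x hx => ⟨?_, ?_⟩⟩
    · have := (killingAt_iff hcov he hU (hWU hx) ((hXx x hx).fieldDiffAt le_top)).1 (h x hx).1
      simpa only [(h x hx).2] using this
    · exact (pfaffAt_of_killing hcov he hU (hWU hx) ((hXx x hx).of_le le_top)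
        (Filter.eventually_of_mem (hW.mem_nhds hx) fun y hy => (h y hy).1)).congr
        (fun i => (hc x hx i).symm) (ha x hx)

/-- The coefficients of the undifferentiated components in the expression of the second
derivatives of a Killing field. -/
def secondOrderB
    (cov : CovariantDerivative (𝓡 n) (EuclideanSpace ℝ (Fin n)) (TangentSpace (𝓡 n) : M → Type _))
    (e : Fin n → VField n M) (l k i j : Fin n) (y : M) : ℝ :=
  ∑ m, connForm cov e i j y (e m y) * connForm cov e m k y (e l y)
    - ∑ m, connForm cov e m j y (e k y) * connForm cov e i m y (e l y)
    - curvCoeff cov e i k j l y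
    - dirDeriv (e l) (fun z => connForm cov e i j z (e k z)) y

/-- The coefficients of the first derivatives in the expression of the second derivatives of a
Killing field. -/
def secondOrderC
    (cov : CovariantDerivative (𝓡 n) (EuclideanSpace ℝ (Fin n)) (TangentSpace (𝓡 n) : M → Type _))
    (e : Fin n → VField n M) (l k i j m : Fin n) (y : M) : ℝ :=
  (if j = i then 1 else 0) * connForm cov e m k y (e l y)
    - (if m = k then 1 else 0) * connForm cov e i j y (e l y)
    - (if m = l then 1 else 0) * connForm cov e i j y (e k y)

variable (hcov : IsLeviCivita cov) (he : IsOrthonormalFrameOn e U) (hU : IsOpen U) (hx : x ∈ U)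
include hcov he hU hx

theorem secondOrderB_contDiffAt (l k' i j : Fin n) :
    FunContDiffAt (n := n) k (secondOrderB cov e l k' i j) x := by
  have hΓ : ∀ {k} i j l, FunContDiffAt (n := n) k (fun y => connForm cov e i j y (e l y)) x :=
    fun i j l => connForm_frame_contDiffAt hcov he hU hx i j l
  exact (((FunContDiffAt.sum fun m _ => (hΓ i j m).mul (hΓ m k' l)).sub
    (FunContDiffAt.sum fun m _ => (hΓ m j k').mul (hΓ i m l))).sub
    (curvCoeff_contDiffAt hcov he hU hx i k' j l)).sub
    (dirDeriv_contDiffAt he hU hx (he.contDiffAt hU hx l) (hΓ i j k'))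

theorem secondOrderC_contDiffAt (l k' i j m : Fin n) :
    FunContDiffAt (n := n) k (secondOrderC cov e l k' i j m) x := by
  have hΓ : ∀ i j l, FunContDiffAt (n := n) k (fun y => connForm cov e i j y (e l y)) x :=
    fun i j l => connForm_frame_contDiffAt hcov he hU hx i j l
  exact ((((FunContDiffAt.const _).mul (hΓ m k' l)).sub
    ((FunContDiffAt.const _).mul (hΓ i j l))).sub ((FunContDiffAt.const _).mul (hΓ i j k')))

/-- The equation θ^i_k = 0 on `e l` gives the derivative of ξ^i_k, and ξ^i_k is `e_k ξ^i` plus a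
term linear in the components. Differentiating that term produces the derivative of ω^i_j(e_k) in
`secondOrderB` and the last term of `secondOrderC`. -/
theorem second_derivative_eq (hX : FieldContDiffAt 2 X x)
    (hP : PfaffAt e (connForm cov e) (curvCoeff cov e) (comp e X)
      (jetComp e (connForm cov e) X) x) (l k i : Fin n) :
    mvfderiv (𝓡 n) (fun y => mvfderiv (𝓡 n) (comp e X i) y (e k y)) x (e l x) =
      ∑ j, secondOrderB cov e l k i j x * comp e X j x +
      ∑ j, ∑ m, secondOrderC cov e l k i j m x * mvfderiv (𝓡 n) (comp e X j) x (e m x) := by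
  set Γ := connForm cov e with hΓdef
  have e2 : (2 : ℕ∞) = 1 + 1 := by norm_num
  have hA : MDifferentiableAt (𝓡 n) 𝓘(ℝ, ℝ) (jetComp e Γ X i k) x :=
    (jetComp_contDiffAt hcov he hU hx (k := 1) (e2 ▸ hX) i k).mdifferentiableAt le_rfl
  have hξ : ∀ m, MDifferentiableAt (𝓡 n) 𝓘(ℝ, ℝ) (comp e X m) x := fun m =>
    he.comp_mdifferentiableAt hU hx (hX.fieldDiffAt (by norm_num)) m
  have hΓ : ∀ m, MDifferentiableAt (𝓡 n) 𝓘(ℝ, ℝ) (fun y => Γ i m y (e k y)) x := fun m =>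
    (connForm_frame_contDiffAt (k := 1) hcov he hU hx i m k).mdifferentiableAt le_rfl
  have hs := hasDeriv_finset_sum (s := Finset.univ)
    (f := fun m y => comp e X m y * Γ i m y (e k y)) fun m _ => (hξ m).mul (hΓ m)
  have hfun : (fun y => mvfderiv (𝓡 n) (comp e X i) y (e k y)) =
      fun y => jetComp e Γ X i k y - ∑ m, comp e X m y * Γ i m y (e k y) :=
    funext fun y => (add_sub_cancel_right _ _).symm
  have h1 := (hP (e l x)).2 i k
  change mvfderiv (𝓡 n) (jetComp e Γ X i k) x (e l x)
    - ∑ m, jetComp e Γ X i m x * Γ m k x (e l x)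
    + ∑ m, jetComp e Γ X m k x * Γ i m x (e l x)
    + ∑ m, ∑ p, comp e X m x * curvCoeff cov e i k m p x * coframe e p x (e l x) = 0 at h1
  simp only [coframe_frame he hx, mul_ite, mul_one, mul_zero, Finset.sum_ite_eq',
    Finset.mem_univ, if_true] at h1
  rw [hfun, mvfderiv_fun_sub hA hs.1, sub_apply, hs.2, sum_apply]
  simp only [fun m => mvfderiv_fun_mul (hξ m) (hΓ m), add_apply, smul_apply, smul_eq_mul,
    Finset.sum_add_distrib]
  have h2 : ∑ m, jetComp e Γ X i m x * Γ m k x (e l x) =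
      ∑ m, Γ m k x (e l x) * mvfderiv (𝓡 n) (comp e X i) x (e m x) +
      ∑ j, (∑ m, Γ i j x (e m x) * Γ m k x (e l x)) * comp e X j x := by
    simp only [jetComp, add_mul, Finset.sum_add_distrib, Finset.sum_mul]
    rw [Finset.sum_comm (f := fun m j => comp e X j x * Γ i j x (e m x) * Γ m k x (e l x))]
    simp only [mul_comm, mul_left_comm]
  have h3 : ∑ m, jetComp e Γ X m k x * Γ i m x (e l x) =
      ∑ j, Γ i j x (e l x) * mvfderiv (𝓡 n) (comp e X j) x (e k x) +
      ∑ j, (∑ m, Γ m j x (e k x) * Γ i m x (e l x)) * comp e X j x := by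
    simp only [jetComp, add_mul, Finset.sum_add_distrib, Finset.sum_mul]
    rw [Finset.sum_comm (f := fun m j => comp e X j x * Γ m j x (e k x) * Γ i m x (e l x))]
    simp only [mul_comm, mul_left_comm]
  have h4 : ∑ j, ∑ m, secondOrderC cov e l k i j m x * mvfderiv (𝓡 n) (comp e X j) x (e m x) =
      ∑ m, Γ m k x (e l x) * mvfderiv (𝓡 n) (comp e X i) x (e m x) -
      ∑ j, Γ i j x (e l x) * mvfderiv (𝓡 n) (comp e X j) x (e k x) -
      ∑ j, Γ i j x (e k x) * mvfderiv (𝓡 n) (comp e X j) x (e l x) := by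
    simp only [secondOrderC, sub_mul, Finset.sum_sub_distrib, ite_mul, one_mul, zero_mul,
      Finset.sum_ite_eq', Finset.mem_univ, if_true, ← hΓdef]
    congr 2
    rw [Finset.sum_comm]
    simp only [Finset.sum_ite_eq', Finset.mem_univ, if_true]
  rw [h4]
  rw [h2, h3] at h1
  simp only [secondOrderB, sub_mul, Finset.sum_sub_distrib, dirDeriv, ← hΓdef]
  have h5 : ∑ j, comp e X j x * curvCoeff cov e i k j l x =
      ∑ j, curvCoeff cov e i k j l x * comp e X j x := by simp only [mul_comm]
  have h6 : ∀ f : Fin n → ℝ, ∑ m, comp e X m x * f m = ∑ m, f m * comp e X m x := fun f => by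
    simp only [mul_comm]
  rw [h6]
  linarith

end IntegralSections
end Killing

end

/-! ### The full statement -/

theorem proposition2p1 {n : ℕ} {M : Type*} [TopologicalSpace M]
    [ChartedSpace (EuclideanSpace ℝ (Fin n)) M] [IsManifold (𝓡 n) ∞ M]
    [RiemannianBundle (fun x : M => TangentSpace (𝓡 n) x)]
    [IsContMDiffRiemannianBundle (𝓡 n) ∞ (EuclideanSpace ℝ (Fin n))
      (fun x : M => TangentSpace (𝓡 n) x)] :
    -- the Levi-Civita connection exists
    (∃ cov : CovariantDerivative (𝓡 n) (EuclideanSpace ℝ (Fin n))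
        (TangentSpace (𝓡 n) : M → Type _), Killing.IsLeviCivita cov) ∧
    ∀ cov : CovariantDerivative (𝓡 n) (EuclideanSpace ℝ (Fin n))
        (TangentSpace (𝓡 n) : M → Type _), Killing.IsLeviCivita cov →
    ∀ (U : Set M), IsOpen U →
    ∀ e : Fin n → Killing.VField n M, Killing.IsOrthonormalFrameOn e U →
    ∀ Γ : Fin n → Fin n → Killing.Form n M, Γ = Killing.connForm cov e →
    ∀ R : Fin n → Fin n → Fin n → Fin n → M → ℝ, R = Killing.curvCoeff cov e →
      -- `Γ i j = ω^i_j` and `R` are the unique solution of the structure equations of the frame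
      (Killing.StructureEquationsOn e U Γ R ∧
        ∀ Γ' R', Killing.StructureEquationsOn e U Γ' R' →
          ∀ x ∈ U, (∀ i j, Γ' i j x = Γ i j x) ∧ ∀ i j k l, R' i j k l x = R i j k l x) ∧
      -- `(ξ^i, ξ^i_j)` are coordinates on the fibres of `J¹(TM)` over `U`
      (∀ x ∈ U, ∃ φ : Killing.OneJet n x ≃ (Fin n → ℝ) × (Fin n → Fin n → ℝ),
        ∀ (X : Killing.VField n M) (hX : Killing.FieldSmoothAt X x),
          φ (Killing.oneJet x X hX) =
            (fun i => Killing.comp e X i x, fun i k => Killing.jetComp e Γ X i k x)) ∧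
      -- `ξ^i_k` are the components of `∇X`, and the Killing equation is `ξ^j_k + ξ^k_j = 0`
      (∀ x ∈ U, ∀ X : Killing.VField n M, Killing.FieldDiffAt X x →
        (∀ k, cov X x (e k x) = ∑ i, Killing.jetComp e Γ X i k x • e i x) ∧
        (Killing.KillingAt X x ↔ Killing.Skew (fun j k => Killing.jetComp e Γ X j k x))) ∧
      -- the forms define an `n`-dimensional distribution, transverse to the fibres of
      -- `J¹(TM)` and tangent to the locus `ξ^j_k + ξ^k_j = 0`
      (∀ x ∈ U, ∀ (ξ : Fin n → ℝ) (a : Fin n → Fin n → ℝ), Killing.Skew a →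
        ∀ v : TangentSpace (𝓡 n) x, ∃ (η : Fin n → ℝ) (α : Fin n → Fin n → ℝ),
          Killing.Skew α ∧
          ∀ (η' : Fin n → ℝ) (α' : Fin n → Fin n → ℝ),
            ((∀ i, Killing.theta₁ e Γ x ξ a i (v, η', α') = 0) ∧
              ∀ i j, Killing.theta₂ e Γ R x ξ a i j (v, η', α') = 0) ↔ η' = η ∧ α' = α) ∧
      -- every solution of class `C²` of the Killing equation satisfies the Pfaffian system
      -- and the equation `∇_Y (∇X) = R(Y, X)`
      (∀ W ⊆ U, IsOpen W → ∀ X : Killing.VField n M, Killing.FieldContDiffOn 2 X W →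
        (∀ x ∈ W, Killing.KillingAt X x) →
        ∀ x ∈ W, Killing.Skew (fun j k => Killing.jetComp e Γ X j k x) ∧
          Killing.PfaffAt e Γ R (Killing.comp e X) (Killing.jetComp e Γ X) x ∧
          ∀ Y Z : Killing.VField n M, Killing.FieldSmoothAt Y x → Killing.FieldSmoothAt Z x →
            Killing.covDerivNabla cov Y X Z x = Killing.curv cov Y X Z x) ∧
      -- smooth integral sections in the locus `ξ^j_k + ξ^k_j = 0` are exactly the 1-jets of
      -- smooth Killing fields
      (∀ W ⊆ U, IsOpen W → ∀ (ξ : Fin n → M → ℝ) (a : Fin n → Fin n → M → ℝ),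
        ((∀ i, Killing.FunSmoothOn (n := n) (ξ i) W) ∧
          (∀ i j, Killing.FunSmoothOn (n := n) (a i j) W) ∧
          ∀ x ∈ W, Killing.Skew (fun j k => a j k x) ∧ Killing.PfaffAt e Γ R ξ a x) ↔
        (Killing.FieldContDiffOn ⊤ (fun x => ∑ i, ξ i x • e i x) W ∧
          ∀ x ∈ W, Killing.KillingAt (fun x => ∑ i, ξ i x • e i x) x ∧
            ∀ i k, a i k x = Killing.jetComp e Γ (fun x => ∑ i, ξ i x • e i x) i k x)) ∧
      -- invariant form of the Pfaffian system
      (∀ W ⊆ U, IsOpen W → ∀ X : Killing.VField n M, Killing.FieldContDiffOn 2 X W →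
        ((∀ x ∈ W, Killing.PfaffAt e Γ R (Killing.comp e X) (Killing.jetComp e Γ X) x) ↔
          ∀ x ∈ W, ∀ Y Z : Killing.VField n M,
            Killing.FieldSmoothAt Y x → Killing.FieldSmoothAt Z x →
            Killing.covDerivNabla cov Y X Z x = Killing.curv cov Y X Z x)) ∧
      -- all second-order derivatives of a solution are linear combinations, with smooth
      -- coefficients, of the solution and its first-order derivatives
      ∃ (B : Fin n → Fin n → Fin n → Fin n → M → ℝ)
        (C : Fin n → Fin n → Fin n → Fin n → Fin n → M → ℝ),
        (∀ l k i j, Killing.FunSmoothOn (n := n) (B l k i j) U) ∧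
        (∀ l k i j m, Killing.FunSmoothOn (n := n) (C l k i j m) U) ∧
        ∀ W ⊆ U, IsOpen W → ∀ X : Killing.VField n M, Killing.FieldContDiffOn 2 X W →
          (∀ x ∈ W, Killing.KillingAt X x) →
          ∀ x ∈ W, ∀ l k i,
            mvfderiv (𝓡 n) (fun y => mvfderiv (𝓡 n) (Killing.comp e X i) y (e k y)) x (e l x) =
              ∑ j, B l k i j x * Killing.comp e X j x +
              ∑ j, ∑ m, C l k i j m x * mvfderiv (𝓡 n) (Killing.comp e X j) x (e m x) := by
  refine ⟨⟨Killing.leviCivita n M, Killing.isLeviCivita_leviCivita⟩, ?_⟩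
  rintro cov hcov U hU e he Γ rfl R rfl
  have hSE := Killing.structureEquationsOn hcov he hU
  refine ⟨⟨hSE, fun Γ' R' h' x hx => ⟨fun i j => hSE.form_unique he hU h' hx i j,
    fun i j k l => hSE.curv_unique he hU h' hx i j k l⟩⟩,
    fun x hx => Killing.exists_oneJet_equiv he hU hx _,
    fun x hx X hX => ⟨fun k => Killing.cov_frame_eq_sum hcov he hU hx hX k,
      Killing.killingAt_iff hcov he hU hx hX⟩,
    fun x hx ξ a ha v => Killing.exists_unique_lift hcov he hU hx ξ a ha v,
    fun W hWU hW X hX hK x hx => ?_,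
    fun W hWU hW ξ a => Killing.integral_section_iff hcov he hU hWU hW ξ a,
    fun W hWU hW X hX => ?_,
    fun l k i j => Killing.secondOrderB cov e l k i j,
    fun l k i j m => Killing.secondOrderC cov e l k i j m,
    fun l k i j x hx => ContMDiffAt.contMDiffWithinAt
      (Killing.secondOrderB_contDiffAt (k := ⊤) hcov he hU hx l k i j),
    fun l k i j m x hx => ContMDiffAt.contMDiffWithinAt
      (Killing.secondOrderC_contDiffAt (k := ⊤) hcov he hU hx l k i j m),
    fun W hWU hW X hX hK x hx l k i => ?_⟩
  · have hXx := hX.fieldContDiffAt hW hx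
    have hP := Killing.pfaffAt_of_killing hcov he hU (hWU hx) hXx
      (Filter.eventually_of_mem (hW.mem_nhds hx) hK)
    exact ⟨(Killing.killingAt_iff hcov he hU (hWU hx) (hXx.fieldDiffAt (by norm_num))).1 (hK x hx),
      hP, (Killing.covDerivNabla_eq_curv_iff hcov he hU (hWU hx) hXx).2 hP⟩
  · exact forall₂_congr fun x hx =>
      (Killing.covDerivNabla_eq_curv_iff hcov he hU (hWU hx) (hX.fieldContDiffAt hW hx)).symm
  · have hXx := hX.fieldContDiffAt hW hx
    exact Killing.second_derivative_eq hcov he hU (hWU hx) hXx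
      (Killing.pfaffAt_of_killing hcov he hU (hWU hx) hXx
        (Filter.eventually_of_mem (hW.mem_nhds hx) hK)) l k i
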